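/- **Theorem 2.1.** Let $M$ be a simply connected (in particular connected) smooth manifold of dimension $m\ge 2$, and let $\nabla$ be a smooth torsion free connection on $TM$. Let $R(X,Y)Z=\nabla_X\nabla_YZ-\nabla_Y\nabla_XZ-\nabla_{[X,Y]}Z$ be the curvature, $\rho(Y,Z)=\operatorname{Tr}(X\mapsto R(X,Y)Z)$ the Ricci tensor, $\rho_s(Y,Z)=\frac12(\rho(Y,Z)+\rho(Z,Y))$, and $(\mathcal H f)(X,Y)=X(Yf)-(\nabla_XY)f$ the Hessian. Put $$\mathcal Q=\mathcal Q(M,\nabla)=\Big\{f\in C^\infty(M):\ \mathcal H f+\tfrac1{m-1}\,f\,\rho_s=0\Big\}.$$ The connection $\nabla$ is called flat if $R=0$, and strongly projectively flat if there is $h\in C^\infty(M)$ such that the connection ${}^h\nabla_XY=\nabla_XY+X(h)Y+Y(h)X$ is flat. 1. Suppose that $\nabla$ is flat, and let $\{1,\phi_1,\dots,\phi_m\}$ be a basis of $\mathcal Q$. Let $\Phi=(\phi_1,\dots,\phi_m):M\to\mathbb R^m$. Then the Jacobian determinant $\det(\partial\phi_i/\partial x^j)$ does not vanish at any point of $M$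 (in any local coordinates), and $\nabla=\Phi^*\nabla_0$, where $\nabla_0$ is the connection on $\mathbb R^m$ whose Christoffel symbols in the standard coordinates all vanish. 2. Suppose that $m=2$ and that $\nabla$ is strongly projectively flat. Let $(x^1,x^2)$ be local coordinates on a non-empty open subset $\mathcal O$ of $M$ (for instance global coordinates, $\mathcal O=M$). Then there are no real functions $g$ of two variables and $f_1,f_2,f_3$ of one variable such that, on $\mathcal O$, $$\{u|_{\mathcal O}:u\in\mathcal Q\}=e^{g(x^1,x^2)}\operatorname{Span}_{\mathbb R}\{f_1(x^1),f_2(x^1),f_3(x^1)\}.$$ -/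

import Mathlib

open scoped Manifold ContDiff Bundle

noncomputable section

namespace AffineManifold

/-- Connections on the tangent bundle of an `m`-dimensional manifold `M`. As in Mathlib,
`∇_u Y` at the point `p` (with `u` a tangent vector at `p`) is written `cov Y p u`. -/
abbrev Connection (m : ℕ) (M : Type*) [TopologicalSpace M]
    [ChartedSpace (EuclideanSpace ℝ (Fin m)) M] [IsManifold (𝓡 m) ∞ M] :=
  CovariantDerivative (𝓡 m) (EuclideanSpace ℝ (Fin m))
    (TangentSpace (𝓡 m) : M → Type _)

section

variable {m : ℕ} {M : Type*} [TopologicalSpace M]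
  [ChartedSpace (EuclideanSpace ℝ (Fin m)) M] [IsManifold (𝓡 m) ∞ M]

/-- Smooth vector fields on `M`. -/
def IsSmoothField (X : Π p : M, TangentSpace (𝓡 m) p) : Prop :=
  ContMDiff (𝓡 m) (𝓡 m).tangent ∞ fun p ↦ (⟨p, X p⟩ : TangentBundle (𝓡 m) M)

/-- `(M, cov)` is an affine manifold: the connection is smooth and torsion free. -/
structure IsAffine (cov : Connection m M) : Prop where
  smooth : CovariantDerivative.ContMDiffCovariantDerivative cov ∞
  torsion_free : cov.torsion = 0

/-- The perturbed connection `∇_X Y + X(g) Y + Y(g) X`. -/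
def perturb (g : M → ℝ) (cov : Connection m M) : Connection m M where
  toFun Y p := cov Y p + (mvfderiv (𝓡 m) g p).smulRight (Y p) +
    (mvfderiv (𝓡 m) g p (Y p)) • ContinuousLinearMap.id ℝ (TangentSpace (𝓡 m) p)
  isCovariantDerivativeOnUniv :=
    { add := by
        intro Y Y' p hY hY' _
        rw [cov.isCovariantDerivativeOnUniv.add hY hY']
        ext1 u
        have h : mvfderiv (𝓡 m) g p (Y p + Y' p) =
          mvfderiv (𝓡 m) g p (Y p) + mvfderiv (𝓡 m) g p (Y' p) := map_add _ _ _
        simp [-smul_add, -map_add, h]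
        module
      leibniz := by
        intro Y f p hY hf _
        rw [cov.isCovariantDerivativeOnUniv.leibniz hY hf]
        ext1 u
        simp [-smul_add, -map_add]
        module }

/-- The curvature operator
`R(X, Y) Z = ∇_X ∇_Y Z - ∇_Y ∇_X Z - ∇_[X, Y] Z` at the point `p`. -/
def curvature (cov : Connection m M) (X Y Z : Π p : M, TangentSpace (𝓡 m) p) (p : M) :
    TangentSpace (𝓡 m) p :=
  cov (fun q ↦ cov Z q (Y q)) p (X p) - cov (fun q ↦ cov Z q (X q)) p (Y p)
    - cov Z p (VectorField.mlieBracket (𝓡 m) X Y p)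

/-- The connection is flat: its curvature operator vanishes. -/
def IsFlat (cov : Connection m M) : Prop :=
  ∀ X Y Z : Π p : M, TangentSpace (𝓡 m) p,
    IsSmoothField X → IsSmoothField Y → IsSmoothField Z → ∀ p, curvature cov X Y Z p = 0

/-- The connection is strongly projectively equivalent to a flat connection. -/
def IsStronglyProjectivelyFlat (cov : Connection m M) : Prop :=
  ∃ g : M → ℝ, ContMDiff (𝓡 m) 𝓘(ℝ, ℝ) ∞ g ∧ IsFlat (perturb g cov)

/-- The curvature tensor on tangent vectors `u, v, w` at `p`, computed with the vector fields
that extend `u, v, w` near `p` with constant components in the preferred chart at `p`. -/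
def curvatureTensor (cov : Connection m M) (p : M)
    (u v w : TangentSpace (𝓡 m) p) : TangentSpace (𝓡 m) p :=
  curvature cov (FiberBundle.extend (EuclideanSpace ℝ (Fin m)) u)
    (FiberBundle.extend (EuclideanSpace ℝ (Fin m)) v)
    (FiberBundle.extend (EuclideanSpace ℝ (Fin m)) w) p

/-- The basis of the tangent space at `p` given by the preferred chart at `p`. -/
def tangentBasis (p : M) : Module.Basis (Fin m) ℝ (TangentSpace (𝓡 m) p) :=
  (EuclideanSpace.basisFun (Fin m) ℝ).toBasis

/-- The Ricci tensor `ρ(v, w) = Tr(z ↦ R(z, v) w)`; the trace is computed in a basis. -/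
def ricci (cov : Connection m M) (p : M)
    (v w : TangentSpace (𝓡 m) p) : ℝ :=
  ∑ i, (tangentBasis p).repr (curvatureTensor cov p (tangentBasis p i) v w) i

/-- The symmetric Ricci tensor. -/
def symRicci (cov : Connection m M) (p : M)
    (v w : TangentSpace (𝓡 m) p) : ℝ :=
  (ricci cov p v w + ricci cov p w v) / 2

/-- The Hessian `(H f)(X, Y) = X(Y f) - (∇_X Y) f` at `p`; on coordinate vector fields this is
`∂ᵢ ∂ⱼ f - Γᵢⱼᵏ ∂ₖ f`. -/
def hessian (cov : Connection m M) (f : M → ℝ) (X Y : Π p : M, TangentSpace (𝓡 m) p)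
    (p : M) : ℝ :=
  mvfderiv (𝓡 m) (fun q ↦ mvfderiv (𝓡 m) f q (Y q)) p (X p) - mvfderiv (𝓡 m) f p (cov Y p (X p))

/-- The space `Q` of smooth solutions `f` of `H f + (1 / (m - 1)) f ρ_s = 0`. -/
def quasiEinstein (cov : Connection m M) : Set (M → ℝ) :=
  {f | ContMDiff (𝓡 m) 𝓘(ℝ, ℝ) ∞ f ∧ ∀ X Y : Π p : M, TangentSpace (𝓡 m) p,
    IsSmoothField X → IsSmoothField Y → ∀ p,
      hessian cov f X Y p + 1 / ((m : ℝ) - 1) * f p * symRicci cov p (X p) (Y p) = 0}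

/-- The Jacobian determinant `det (∂φᵢ / ∂xʲ)` at `p` in the local coordinates `x`. -/
def jacobianDet (x : OpenPartialHomeomorph M (EuclideanSpace ℝ (Fin m))) (φ : Fin m → M → ℝ)
    (p : M) : ℝ :=
  Matrix.det (Matrix.of fun i j : Fin m ↦
    fderiv ℝ (φ i ∘ x.symm) (x p) (EuclideanSpace.single j 1))

/-- `cov` is the pull-back `Φ^* cov'` of `cov'` by a local diffeomorphism `Φ`, that is,
`∇_v (Φ^* W) = (dΦ)⁻¹ (∇'_{dΦ v} W)` for all vector fields `W` on the target, where
`Φ^* W = (dΦ)⁻¹ W`. (As the fields `Φ^* W` contain local frames, this determines `cov`.) -/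
def IsPullback {N : Type*} [TopologicalSpace N] [ChartedSpace (EuclideanSpace ℝ (Fin m)) N]
    [IsManifold (𝓡 m) ∞ N]
    (Φ : M → N) (cov' : Connection m N) (cov : Connection m M) : Prop :=
  ∀ (W : Π y : N, TangentSpace (𝓡 m) y) (p : M),
    MDifferentiableAt (𝓡 m) (𝓡 m).tangent (fun y ↦ (⟨y, W y⟩ : TangentBundle (𝓡 m) N)) (Φ p) →
    ∀ v : TangentSpace (𝓡 m) p,
      cov (VectorField.mpullback (𝓡 m) (𝓡 m) Φ W) p v =
        (mfderiv (𝓡 m) (𝓡 m) Φ p).inverse (cov' W (Φ p) (mfderiv (𝓡 m) (𝓡 m) Φ p v))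

end

/-- A vector field on `ℝᵐ` that is differentiable as a section of the tangent bundle is
differentiable as a vector-valued function. -/
theorem differentiableAt_of_field {m : ℕ}
    {W : Π y : EuclideanSpace ℝ (Fin m), TangentSpace (𝓡 m) y} {y : EuclideanSpace ℝ (Fin m)}
    (hW : MDifferentiableAt (𝓡 m) (𝓡 m).tangent
      (fun z ↦ (⟨z, W z⟩ : TangentBundle (𝓡 m) (EuclideanSpace ℝ (Fin m)))) y) :
    DifferentiableAt ℝ (fun z ↦ (W z : EuclideanSpace ℝ (Fin m))) y := by
  rw [mdifferentiableAt_section, mdifferentiableAt_iff_differentiableAt] at hW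
  simpa using hW

/-- The trivial connection on `ℝᵐ`: the usual directional derivative of vector fields, whose
Christoffel symbols in the standard coordinates all vanish. -/
def trivialConnection (m : ℕ) : Connection m (EuclideanSpace ℝ (Fin m)) where
  toFun W y := fderiv ℝ (fun z ↦ (W z : EuclideanSpace ℝ (Fin m))) y
  isCovariantDerivativeOnUniv :=
    { add := by
        intro W W' y hW hW' _
        exact fderiv_add (differentiableAt_of_field hW) (differentiableAt_of_field hW')
      leibniz := by
        intro W f y hW hf _
        have hf' : DifferentiableAt ℝ f y := hf.differentiableAt
        refine (fderiv_smul hf' (differentiableAt_of_field hW)).trans ?_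
        ext1 u
        simp [mvfderiv, mfderiv_eq_fderiv]
        rfl }

end AffineManifold

end

open scoped Manifold ContDiff Bundle

noncomputable section

namespace AffineManifold

open Set Metric Filter Topology

set_option maxSynthPendingDepth 3

set_option linter.unusedSectionVars false

/-! ### Linear total differential equations dF = A F on a normed space -/

section Frobenius

variable {E V : Type*} [NormedAddCommGroup E] [NormedSpace ℝ E]
  [NormedAddCommGroup V] [NormedSpace ℝ V]

/-! Call a function affine if its Hessian vanishes. In coordinates the first jet (f, df) of an
affine function solves a linear total differential equation whose integrability condition follows
from symmetry of the Christoffel symbols and vanishing of the curvature (`jetForm_integrable`). So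
for a flat torsion-free connection affine functions exist locally with any prescribed jet, and that
jet determines them (`HasFlatSymbols.exists_local`). Connectedness makes the uniqueness global
(`HasFlatSymbols.jet_eq_zero`). Simple connectedness makes the existence global: jets, taken with
the discrete topology, form a covering of M, and a section is a lift of the identity
(`exists_global_section`, `HasFlatSymbols.exists_affine`).

Part 1. A flat connection has no Ricci tensor, so solutions are affine. Were the Jacobian singular
at p, some nontrivial combination of the φᵢ would have a critical point at p and hence be constant
(`HasFlatSymbols.eq_const`), against independence from 1. So Φ is a local diffeomorphism. The
vanishing of the Hessians reads dφᵢ(∇_v Y) = v(Y φᵢ), which for Y = Φ^* W says that dΦ carries ∇_v Y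
to the directional derivative of W (`isPullback_trivialConnection`).

Part 2. If the perturbation by h is flat, the projective change of curvature gives ρ_s = (m -
1)(Hess h - dh ⊗ dh) (`symRicci_eq_of_isFlat_perturb`), and multiplication by e^{-h} turns affine
functions of the flat connection into solutions (`exp_neg_mul_mem_quasiEinstein`). Thus e^{-h} and
e^{-h} φ are solutions for every such affine φ. If both had the form e^g k(x¹), their quotient φ
would depend on x¹ alone; but some global affine φ has a nonzero derivative in another coordinate
direction at a given point (`exists_affine_fderiv_ne_zero`). -/

theorem norm_le_of_norm_deriv_le_half {d d' : ℝ → V} {δ ε : ℝ} (hδ : 0 ≤ δ) (hε : 0 ≤ ε)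
    (hd : ∀ t ∈ Icc (0 : ℝ) 1, HasDerivWithinAt d (d' t) (Icc 0 1) t) (h0 : ‖d 0‖ ≤ δ)
    (hb : ∀ t ∈ Icc (0 : ℝ) 1, ‖d' t‖ ≤ 1 / 2 * ‖d t‖ + ε) :
    ∀ t ∈ Icc (0 : ℝ) 1, ‖d t‖ ≤ 2 * δ + 2 * ε := by
  intro t ht
  -- Since e < 4, exp(1/2) < 2; this turns the Grönwall bound δ e^{t/2} + 2ε (e^{t/2} - 1) into 2δ +
  -- 2ε.
  have hexp : Real.exp (1 / 2 * t) ≤ 2 := by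
    have h2 : Real.exp (1 / 2 * t) ≤ Real.exp (1 / 2) := Real.exp_le_exp.2 (by linarith [ht.2])
    have h3 : Real.exp (1 / 2) * Real.exp (1 / 2) = Real.exp 1 := by
      rw [← Real.exp_add]; norm_num
    nlinarith [Real.exp_one_lt_d9, Real.exp_pos (1 / 2 : ℝ)]
  have key := norm_le_gronwallBound_of_norm_deriv_right_le (f := d) (f' := d') (δ := δ)
    (K := 1 / 2) (ε := ε) (a := 0) (b := 1) (fun s hs ↦ (hd s hs).continuousWithinAt)
    (fun s hs ↦ (hd s ⟨hs.1, hs.2.le⟩).mono_of_mem_nhdsWithin (Icc_mem_nhdsGE_of_mem hs)) h0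
    (fun s hs ↦ hb s ⟨hs.1, hs.2.le⟩) t ht
  rw [gronwallBound_of_K_ne_0 (by norm_num)] at key
  simp only [sub_zero] at key
  have h4 := mul_le_mul_of_nonneg_left hexp hδ
  have h5 := mul_le_mul_of_nonneg_left hexp hε
  have : ε / (1 / 2) * (Real.exp (1 / 2 * t) - 1) = 2 * (ε * Real.exp (1 / 2 * t)) - 2 * ε := by
    ring
  linarith

/-- Picard–Lindelöf on the closed ball of radius ‖v‖ about v: points there have norm at most 2‖v‖,
so ‖B‖ ≤ 1/2 keeps the speed at most ‖v‖ and the solution cannot leave before time 1. -/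
theorem exists_hasDerivWithinAt_linear [CompleteSpace V] {B : ℝ → V →L[ℝ] V}
    (hB : ContinuousOn B (Icc 0 1)) (hbound : ∀ t ∈ Icc (0 : ℝ) 1, ‖B t‖ ≤ 1 / 2) (v : V) :
    ∃ F : ℝ → V, F 0 = v ∧
      ∀ t ∈ Icc (0 : ℝ) 1, HasDerivWithinAt F (B t (F t)) (Icc 0 1) t := by
  have hpl : IsPicardLindelof (fun t x ↦ B t x) (tmin := 0) (tmax := 1) ⟨0, by simp⟩ v
      ‖v‖₊ 0 ‖v‖₊ (1 / 2) := by
    refine ⟨fun t ht ↦ ?_, fun x _ ↦ hB.clm_apply continuousOn_const, fun t ht x hx ↦ ?_, ?_⟩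
    · refine LipschitzOnWith.of_dist_le_mul fun x _ y _ ↦ ?_
      rw [dist_eq_norm, dist_eq_norm, ← map_sub]
      refine ((B t).le_opNorm _).trans ?_
      have := hbound t ht
      gcongr
      simpa using this
    · have h1 : ‖x‖ ≤ 2 * ‖v‖ := by
        rw [mem_closedBall, dist_eq_norm] at hx
        have := norm_le_norm_sub_add x v
        simp only [coe_nnnorm] at hx
        linarith
      calc ‖B t x‖ ≤ ‖B t‖ * ‖x‖ := (B t).le_opNorm _
        _ ≤ 1 / 2 * (2 * ‖v‖) := by
          have := hbound t ht
          gcongr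
        _ = ‖v‖₊ := by simp
    · simp
  obtain ⟨F, h0, hF⟩ := hpl.exists_eq_forall_mem_Icc_hasDerivWithinAt₀
  exact ⟨F, h0, hF⟩

/-- Local solvability of the total differential equation `dF = A F`, under the integrability
condition that makes the second derivative of a solution symmetric. -/
theorem exists_hasFDerivAt_of_integrable_zero [CompleteSpace V] {A : E → E →L[ℝ] V →L[ℝ] V}
    {A' : E → E →L[ℝ] E →L[ℝ] V →L[ℝ] V} {ρ K K₁ K₂ : ℝ} (hρ : 0 < ρ)
    (hA : ∀ z ∈ ball (0 : E) ρ, HasFDerivAt A (A' z) z)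
    (hK : ∀ z ∈ ball (0 : E) ρ, ‖A z‖ ≤ K) (hKρ : K * ρ ≤ 1 / 2)
    (hK₁ : ∀ z ∈ ball (0 : E) ρ, ‖A' z‖ ≤ K₁)
    (hK₂ : ∀ z ∈ ball (0 : E) ρ, ∀ w ∈ ball (0 : E) ρ, ‖A' w - A' z‖ ≤ K₂ * ‖w - z‖)
    (hint : ∀ z ∈ ball (0 : E) ρ, ∀ u v,
      A' z u v + A z v ∘L A z u = A' z v u + A z u ∘L A z v) (v₀ : V) :
    ∃ F : E → V, F 0 = v₀ ∧ ∀ x ∈ ball (0 : E) ρ, HasFDerivAt F ((A x).flip (F x)) x := by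
  have h0 : (0 : E) ∈ ball (0 : E) ρ := mem_ball_self hρ
  have hK0 : 0 ≤ K := (norm_nonneg _).trans (hK 0 h0)
  have hK₁0 : 0 ≤ K₁ := (norm_nonneg _).trans (hK₁ 0 h0)
  have hmem : ∀ x ∈ ball (0 : E) ρ, ∀ t ∈ Icc (0 : ℝ) 1, t • x ∈ ball (0 : E) ρ := by
    intro x hx t ht
    rw [mem_ball_zero_iff] at hx ⊢
    rw [norm_smul, Real.norm_of_nonneg ht.1]
    exact (mul_le_of_le_one_left (norm_nonneg _) ht.2).trans_lt hx
  have hB : ∀ x ∈ ball (0 : E) ρ, ∀ t ∈ Icc (0 : ℝ) 1, ‖A (t • x) x‖ ≤ 1 / 2 := by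
    intro x hx t ht
    refine ((A (t • x)).le_opNorm x).trans (le_trans ?_ hKρ)
    have := hK _ (hmem x hx t ht)
    rw [mem_ball_zero_iff] at hx
    gcongr
  have hAd : ∀ x ∈ ball (0 : E) ρ, ∀ t ∈ Icc (0 : ℝ) 1,
      HasDerivAt (fun t : ℝ ↦ A (t • x)) (A' (t • x) x) t := by
    intro x hx t ht
    have h1 : HasDerivAt (fun t : ℝ ↦ t • x) x t := by
      simpa using (hasDerivAt_id t).smul_const x
    exact (hA _ (hmem x hx t ht)).comp_hasDerivAt t h1
  -- The solution is built along rays: G x solves the equation restricted to t ↦ t • x, and F x will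
  -- be G x 1. Off the ball G x is a dummy.
  have hG : ∀ x : E, ∃ G : ℝ → V, x ∈ ball (0 : E) ρ → G 0 = v₀ ∧
      ∀ t ∈ Icc (0 : ℝ) 1, HasDerivWithinAt G (A (t • x) x (G t)) (Icc 0 1) t := by
    intro x
    by_cases hx : x ∈ ball (0 : E) ρ
    · obtain ⟨G, hG⟩ := exists_hasDerivWithinAt_linear (B := fun t ↦ A (t • x) x)
        (fun t ht ↦ ((hAd x hx t ht).clm_apply
          (hasDerivAt_const t x)).continuousAt.continuousWithinAt) (hB x hx) v₀
      exact ⟨G, fun _ ↦ hG⟩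
    · exact ⟨0, fun h ↦ absurd h hx⟩
  choose G hG using hG
  have hGbound : ∀ x ∈ ball (0 : E) ρ, ∀ t ∈ Icc (0 : ℝ) 1, ‖G x t‖ ≤ 2 * ‖v₀‖ := by
    intro x hx t ht
    have := norm_le_of_norm_deriv_le_half (d := G x) (norm_nonneg v₀) le_rfl (hG x hx).2
      (by rw [(hG x hx).1]) (fun t ht ↦ ?_) t ht
    · simpa using this
    · rw [add_zero]
      refine ((A (t • x) x).le_opNorm _).trans ?_
      have := hB x hx t ht
      gcongr
  have hAlip : ∀ x ∈ ball (0 : E) ρ, ∀ y ∈ ball (0 : E) ρ, ∀ t ∈ Icc (0 : ℝ) 1,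
      ‖A (t • y) - A (t • x)‖ ≤ K₁ * ‖y - x‖ := by
    intro x hx y hy t ht
    have h1 := (convex_ball (0 : E) ρ).norm_image_sub_le_of_norm_hasFDerivWithin_le
      (fun z hz ↦ (hA z hz).hasFDerivWithinAt) hK₁ (hmem x hx t ht) (hmem y hy t ht)
    refine h1.trans ?_
    rw [← smul_sub, norm_smul, Real.norm_of_nonneg ht.1]
    gcongr
    exact mul_le_of_le_one_left (norm_nonneg _) ht.2
  have hBlip : ∀ x ∈ ball (0 : E) ρ, ∀ y ∈ ball (0 : E) ρ, ∀ t ∈ Icc (0 : ℝ) 1,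
      ‖A (t • y) y - A (t • x) x‖ ≤ (K₁ * ρ + K) * ‖y - x‖ := by
    intro x hx y hy t ht
    have e : A (t • y) y - A (t • x) x = (A (t • y) - A (t • x)) y + A (t • x) (y - x) := by
      simp
    rw [e]
    refine (norm_add_le _ _).trans ?_
    have h1 := (A (t • y) - A (t • x)).le_opNorm y
    have h2 := (A (t • x)).le_opNorm (y - x)
    have h3 := hAlip x hx y hy t ht
    have h4 := hK _ (hmem x hx t ht)
    have h5 : ‖y‖ ≤ ρ := by rw [mem_ball_zero_iff] at hy; exact hy.le
    calc _ ≤ ‖A (t • y) - A (t • x)‖ * ‖y‖ + ‖A (t • x)‖ * ‖y - x‖ := add_le_add h1 h2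
      _ ≤ (K₁ * ‖y - x‖) * ρ + K * ‖y - x‖ := by gcongr
      _ = _ := by ring
  set L := K₁ * ρ + K with hL
  have hL0 : 0 ≤ L := by positivity
  have hGlip : ∀ x ∈ ball (0 : E) ρ, ∀ y ∈ ball (0 : E) ρ, ∀ t ∈ Icc (0 : ℝ) 1,
      ‖G y t - G x t‖ ≤ 4 * L * ‖v₀‖ * ‖y - x‖ := by
    intro x hx y hy t ht
    have := norm_le_of_norm_deriv_le_half (d := fun t ↦ G y t - G x t) (δ := 0)
      (ε := L * ‖y - x‖ * (2 * ‖v₀‖)) le_rfl (by positivity)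
      (fun t ht ↦ ((hG y hy).2 t ht).sub ((hG x hx).2 t ht))
      (by rw [(hG x hx).1, (hG y hy).1]; simp) (fun t ht ↦ ?_) t ht
    · refine this.trans (le_of_eq (by ring))
    · have e : A (t • y) y (G y t) - A (t • x) x (G x t) =
          A (t • x) x (G y t - G x t) + (A (t • y) y - A (t • x) x) (G y t) := by
        simp
      rw [e]
      refine (norm_add_le _ _).trans (add_le_add ?_ ?_)
      · refine ((A (t • x) x).le_opNorm _).trans ?_
        have := hB x hx t ht
        gcongr
      · refine ((A (t • y) y - A (t • x) x).le_opNorm _).trans ?_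
        have := hBlip x hx y hy t ht
        have := hGbound y hy t ht
        gcongr
  have hAquad : ∀ x ∈ ball (0 : E) ρ, ∀ y ∈ ball (0 : E) ρ, ∀ t ∈ Icc (0 : ℝ) 1,
      ‖A (t • y) - A (t • x) - t • A' (t • x) (y - x)‖ ≤ |K₂| * ‖y - x‖ * ‖y - x‖ := by
    intro x hx y hy t ht
    have hseg : segment ℝ (t • x) (t • y) ⊆ ball (0 : E) ρ :=
      (convex_ball (0 : E) ρ).segment_subset (hmem x hx t ht) (hmem y hy t ht)
    have hle : ‖t • y - t • x‖ ≤ ‖y - x‖ := by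
      rw [← smul_sub, norm_smul, Real.norm_of_nonneg ht.1]
      exact mul_le_of_le_one_left (norm_nonneg _) ht.2
    have h1 := (convex_segment (t • x) (t • y)).norm_image_sub_le_of_norm_hasFDerivWithin_le'
      (φ := A' (t • x)) (C := |K₂| * ‖y - x‖)
      (fun z hz ↦ (hA z (hseg hz)).hasFDerivWithinAt) (fun z hz ↦ ?_)
      (left_mem_segment ℝ _ _) (right_mem_segment ℝ _ _)
    · rw [← smul_sub, map_smul] at h1
      refine h1.trans ?_
      rw [smul_sub]
      gcongr
    · refine (hK₂ _ (hmem x hx t ht) z (hseg hz)).trans ?_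
      have h2 : ‖z - t • x‖ ≤ ‖t • y - t • x‖ := by
        rw [segment_eq_image'] at hz
        obtain ⟨s, hs, rfl⟩ := hz
        simp only [add_sub_cancel_left]
        rw [norm_smul, Real.norm_of_nonneg hs.1]
        exact mul_le_of_le_one_left (norm_nonneg _) hs.2
      calc K₂ * ‖z - t • x‖ ≤ |K₂| * ‖z - t • x‖ := by gcongr; exact le_abs_self _
        _ ≤ |K₂| * ‖y - x‖ := by gcongr; exact h2.trans hle
  -- At x = 0 the ray equation has zero right-hand side, so G 0 stays equal to v₀.
  refine ⟨fun x ↦ G x 1, ?_, fun x hx ↦ ?_⟩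
  · have := norm_le_of_norm_deriv_le_half (d := fun t ↦ G 0 t - v₀) (δ := 0) (ε := 0) le_rfl
      le_rfl (fun t ht ↦ ((hG 0 h0).2 t ht).sub_const v₀) (by simp [(hG 0 h0).1])
      (fun t ht ↦ by simp) 1 (by simp)
    simpa [sub_eq_zero] using this
  · set C := |K₂| * ρ * (2 * ‖v₀‖) + K₁ * (2 * ‖v₀‖) + L * (4 * L * ‖v₀‖) with hC
    have hC0 : 0 ≤ C := by positivity
    -- The first-order remainder d(t) = G y t - G x t - t A(tx)(y - x)(G x t) obeys d' = A(tx) x d +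
    -- O(‖y - x‖²), and d(0) = 0. The three summands of C bound the three quadratic errors.
    have key : ∀ y ∈ ball (0 : E) ρ,
        ‖G y 1 - G x 1 - A x (y - x) (G x 1)‖ ≤ 2 * C * ‖y - x‖ ^ 2 := by
      intro y hy
      have := norm_le_of_norm_deriv_le_half
        (d := fun t ↦ G y t - G x t - t • (A (t • x) (y - x) (G x t)))
        (δ := 0) (ε := C * ‖y - x‖ ^ 2) le_rfl (by positivity)
        (fun t ht ↦ (((hG y hy).2 t ht).sub ((hG x hx).2 t ht)).sub
          ((hasDerivAt_id t).hasDerivWithinAt.smul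
            ((((hAd x hx t ht).clm_apply (hasDerivAt_const t (y - x))).hasDerivWithinAt).clm_apply
              ((hG x hx).2 t ht))))
        (by rw [(hG x hx).1, (hG y hy).1]; simp) (fun t ht ↦ ?_) 1 (by simp)
      · simp only [one_smul] at this
        refine this.trans (le_of_eq (by ring))
      -- Integrability enters here: it exchanges the derivative of A along x, produced by
      -- differentiating in t, for the derivative along y - x, which is the one in the Taylor
      -- expansion of A.
      · have hi := congr($(hint (t • x) (hmem x hx t ht) x (y - x)) (G x t))
        simp only [add_apply, ContinuousLinearMap.comp_apply] at hi
        have e : A (t • y) y (G y t) - A (t • x) x (G x t) -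
            (id t • ((A' (t • x) x (y - x) + A (t • x) 0) (G x t) +
              A (t • x) (y - x) (A (t • x) x (G x t))) + (1 : ℝ) • A (t • x) (y - x) (G x t)) =
            A (t • x) x (G y t - G x t - t • A (t • x) (y - x) (G x t)) +
            ((A (t • y) - A (t • x) - t • A' (t • x) (y - x)) x (G x t) +
            (A (t • y) - A (t • x)) (y - x) (G x t) +
            (A (t • y) y - A (t • x) x) (G y t - G x t)) := by
          simp only [map_zero, add_zero, id, hi]
          simp
          module
        refine (le_of_eq (congrArg norm e)).trans ?_
        refine (norm_add_le _ _).trans (add_le_add ?_ ?_)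
        · refine ((A (t • x) x).le_opNorm _).trans ?_
          have := hB x hx t ht
          gcongr
        · have hxρ : ‖x‖ ≤ ρ := by rw [mem_ball_zero_iff] at hx; exact hx.le
          have b := hGbound x hx t ht
          have b1 : ‖(A (t • y) - A (t • x) - t • A' (t • x) (y - x)) x (G x t)‖ ≤
              |K₂| * ‖y - x‖ * ‖y - x‖ * ρ * (2 * ‖v₀‖) := by
            refine (ContinuousLinearMap.le_opNorm₂ _ _ _).trans ?_
            have := hAquad x hx y hy t ht
            gcongr
          have b2 : ‖(A (t • y) - A (t • x)) (y - x) (G x t)‖ ≤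
              K₁ * ‖y - x‖ * ‖y - x‖ * (2 * ‖v₀‖) := by
            refine (ContinuousLinearMap.le_opNorm₂ _ _ _).trans ?_
            have := hAlip x hx y hy t ht
            gcongr
          have b3 : ‖(A (t • y) y - A (t • x) x) (G y t - G x t)‖ ≤
              L * ‖y - x‖ * (4 * L * ‖v₀‖ * ‖y - x‖) := by
            refine (ContinuousLinearMap.le_opNorm _ _).trans ?_
            have := hBlip x hx y hy t ht
            have := hGlip x hx y hy t ht
            gcongr
          refine (norm_add₃_le).trans ((add_le_add (add_le_add b1 b2) b3).trans (le_of_eq ?_))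
          rw [hC]; ring
    have hO : (fun y ↦ G y 1 - G x 1 - A x (y - x) (G x 1)) =O[𝓝 x] fun y ↦ ‖y - x‖ ^ 2 := by
      refine Asymptotics.IsBigO.of_bound (2 * C) ?_
      filter_upwards [isOpen_ball.mem_nhds hx] with y hy
      simpa using key y hy
    have h2 := hO.hasFDerivAt (𝕜 := ℝ) (by norm_num)
    have h3 : HasFDerivAt (fun y ↦ A x (y - x) (G x 1)) ((A x).flip (G x 1)) x := by
      exact (((A x).flip (G x 1)).hasFDerivAt.comp x
        ((hasFDerivAt_id x).sub_const x)).congr_fderiv (by ext; simp)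
    have h4 := (h2.add h3).add_const (G x 1)
    simpa using! h4

/-- Uniform local solvability near `y₀` of an integrable smooth total differential equation. -/
theorem exists_ball_hasFDerivAt_of_integrable [CompleteSpace V] {A : E → E →L[ℝ] V →L[ℝ] V}
    {y₀ : E} {s : Set E} (hs : IsOpen s) (hy₀ : y₀ ∈ s) (hA : ContDiffOn ℝ ∞ A s)
    (hint : ∀ z ∈ s, ∀ u v,
      fderiv ℝ A z u v + A z v ∘L A z u = fderiv ℝ A z v u + A z u ∘L A z v) :
    ∃ r > 0, ball y₀ r ⊆ s ∧ ∀ y₁ ∈ ball y₀ r, ∀ v : V, ∃ F : E → V, F y₁ = v ∧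
      ∀ x ∈ ball y₀ r, HasFDerivAt F ((A x).flip (F x)) x := by
  have hA₀ : ContDiffAt ℝ ∞ A y₀ := hA.contDiffAt (hs.mem_nhds hy₀)
  have hA' : ContDiffAt ℝ 1 (fderiv ℝ A) y₀ := hA₀.fderiv_right (by norm_cast)
  -- K₂ is a local Lipschitz constant of the derivative of A. Below, R/3 makes the ball of radius 2r
  -- about any y₁ contain `ball y₀ r` and lie in `ball y₀ R`, and 1/(4K) yields K · 2r ≤ 1/2.
  obtain ⟨K₂, t, ht, hlip⟩ := hA'.exists_lipschitzOnWith
  set K := ‖A y₀‖ + 1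
  have e1 : ∀ᶠ z in 𝓝 y₀, ‖A z‖ < K := hA₀.continuousAt.norm.eventually_lt_const (by simp [K])
  have e2 : ∀ᶠ z in 𝓝 y₀, ‖fderiv ℝ A z‖ < ‖fderiv ℝ A y₀‖ + 1 :=
    hA'.continuousAt.norm.eventually_lt_const (by simp)
  obtain ⟨R, hR, hball⟩ := Metric.mem_nhds_iff.1
    (inter_mem (inter_mem ht (hs.mem_nhds hy₀)) (e1.and e2))
  have hK0 : 0 < K := by positivity
  set r := min (R / 3) (1 / (4 * K))
  have hr : 0 < r := by positivity
  have hr1 : 3 * r ≤ R := by linarith [min_le_left (R / 3) (1 / (4 * K))]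
  have hr2 : K * (2 * r) ≤ 1 / 2 := by
    calc K * (2 * r) ≤ K * (2 * (1 / (4 * K))) := by gcongr; exact min_le_right _ _
      _ = 1 / 2 := by field_simp; norm_num
  refine ⟨r, hr, fun z hz ↦ (hball (ball_subset_ball (by linarith) hz)).1.2,
    fun y₁ hy₁ v ↦ ?_⟩
  have hmem : ∀ z ∈ ball (0 : E) (2 * r), y₁ + z ∈ ball y₀ R := by
    intro z hz
    rw [mem_ball_zero_iff] at hz
    rw [mem_ball, dist_eq_norm] at hy₁ ⊢
    calc ‖y₁ + z - y₀‖ = ‖(y₁ - y₀) + z‖ := by congr 1; abel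
      _ ≤ ‖y₁ - y₀‖ + ‖z‖ := norm_add_le _ _
      _ < R := by linarith
  obtain ⟨F, hF0, hF⟩ := exists_hasFDerivAt_of_integrable_zero (A := fun z ↦ A (y₁ + z))
    (A' := fun z ↦ fderiv ℝ A (y₁ + z)) (ρ := 2 * r) (K := K) (K₁ := ‖fderiv ℝ A y₀‖ + 1)
    (K₂ := K₂) (by positivity)
    (fun z hz ↦ by
      have h1 : HasFDerivAt A (fderiv ℝ A (y₁ + z)) (y₁ + z) :=
        ((hA.contDiffAt (hs.mem_nhds (hball (hmem z hz)).1.2)).differentiableAt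
          (by simp)).hasFDerivAt
      exact (hasFDerivAt_comp_add_left y₁).2 h1)
    (fun z hz ↦ (hball (hmem z hz)).2.1.le) hr2 (fun z hz ↦ (hball (hmem z hz)).2.2.le)
    (fun z hz w hw ↦ by
      have := hlip.norm_sub_le (hball (hmem w hw)).1.1 (hball (hmem z hz)).1.1
      simpa using this)
    (fun z hz ↦ hint _ (hball (hmem z hz)).1.2) v
  refine ⟨fun x ↦ F (x - y₁), by simpa using hF0, fun x hx ↦ ?_⟩
  have h1 := hF (x - y₁) (by
    rw [mem_ball_zero_iff]
    rw [mem_ball, dist_eq_norm] at hx hy₁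
    calc ‖x - y₁‖ = ‖(x - y₀) - (y₁ - y₀)‖ := by congr 1; abel
      _ ≤ ‖x - y₀‖ + ‖y₁ - y₀‖ := norm_sub_le _ _
      _ < 2 * r := by linarith)
  rw [add_sub_cancel] at h1
  exact (hasFDerivAt_comp_sub (f := F) y₁).2 h1

/-- A solution of a smooth total differential equation is smooth. -/
theorem contDiffOn_of_hasFDerivAt {A : E → E →L[ℝ] V →L[ℝ] V} {s : Set E} (hs : IsOpen s)
    (hA : ContDiffOn ℝ ∞ A s) {F : E → V}
    (hF : ∀ x ∈ s, HasFDerivAt F ((A x).flip (F x)) x) : ContDiffOn ℝ ∞ F s := by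
  rw [contDiffOn_infty]
  intro n
  induction n with
  | zero =>
    simp only [Nat.cast_zero, contDiffOn_zero]
    exact fun x hx ↦ (hF x hx).continuousAt.continuousWithinAt
  | succ n ih =>
    push_cast
    rw [contDiffOn_succ_iff_fderiv_of_isOpen hs]
    refine ⟨fun x hx ↦ (hF x hx).differentiableAt.differentiableWithinAt, by simp, ?_⟩
    -- Bootstrap: the equation expresses the derivative of F through A and F, so it is as smooth as
    -- F itself.
    have h1 : ContDiffOn ℝ n (fun x ↦ (A x).flip (F x)) s :=
      (((ContinuousLinearMap.flipₗᵢ ℝ E V V).contDiff.comp_contDiffOn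
        (hA.of_le (by exact_mod_cast le_top)))).clm_apply ih
    exact h1.congr fun x hx ↦ (hF x hx).fderiv

/-- A solution of a linear total differential equation on a ball vanishes if it vanishes at one
point. -/
theorem eq_zero_of_hasFDerivAt {A : E → E →L[ℝ] V →L[ℝ] V} {s : Set E} (hs : Convex ℝ s)
    {K : ℝ} (hK : ∀ z ∈ s, ‖A z‖ ≤ K) {F : E → V}
    (hF : ∀ x ∈ s, HasFDerivAt F ((A x).flip (F x)) x) {y : E} (hy : y ∈ s) (h0 : F y = 0) :
    ∀ x ∈ s, F x = 0 := by
  intro x hx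
  have hmem : ∀ t ∈ Icc (0 : ℝ) 1, y + t • (x - y) ∈ s := fun t ht ↦
    hs.add_smul_sub_mem hy hx ht
  -- On the segment from y to x, F solves a linear ODE with bounded coefficient, so Grönwall
  -- applies.
  have hd : ∀ t ∈ Icc (0 : ℝ) 1, HasDerivAt (fun t : ℝ ↦ F (y + t • (x - y)))
      (A (y + t • (x - y)) (x - y) (F (y + t • (x - y)))) t := by
    intro t ht
    have h1 : HasDerivAt (fun t : ℝ ↦ y + t • (x - y)) (x - y) t := by
      simpa using ((hasDerivAt_id t).smul_const (x - y)).const_add y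
    exact (hF _ (hmem t ht)).comp_hasDerivAt t h1
  have := eq_zero_of_abs_deriv_le_mul_abs_self_of_eq_zero_right (K := K * ‖x - y‖)
    (fun t ht ↦ (hd t ht).continuousAt.continuousWithinAt)
    (fun t ht ↦ (hd t ⟨ht.1, ht.2.le⟩).hasDerivWithinAt) (by simpa using h0)
    (fun t ht ↦ by
      refine (ContinuousLinearMap.le_opNorm₂ _ _ _).trans ?_
      have := hK _ (hmem t ⟨ht.1, ht.2.le⟩)
      gcongr) 1 (by simp)
  simpa using this

end Frobenius

/-! ### Monodromy: from local transports to global sections -/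

/-- Local transports with values in a fixed set, which agree locally on overlaps, on a simply
connected space: every initial value extends to a global section that is locally transported. -/
theorem exists_global_section {X V : Type*} [TopologicalSpace X] [SimplyConnectedSpace X]
    [LocallyPathConnectedSpace X] (U : X → Set X) (hU : ∀ i, IsOpen (U i)) (hi : ∀ i, i ∈ U i)
    (T : X → X → X → V → V)
    (hT_self : ∀ i, ∀ q ∈ U i, ∀ v, T i q q v = v)
    (hT_comp : ∀ i, ∀ q₁ ∈ U i, ∀ q₂ ∈ U i, ∀ q₃ ∈ U i, ∀ v, T i q₂ q₃ (T i q₁ q₂ v) = T i q₁ q₃ v)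
    (hT_compat : ∀ i j, ∀ b ∈ U i ∩ U j, ∀ v, ∀ᶠ b' in 𝓝 b, T j b b' v = T i b b' v)
    (x₀ : X) (v₀ : V) :
    ∃ s : X → V, s x₀ = v₀ ∧ ∀ i, ∀ᶠ b in 𝓝 i, s b = T i i b (s i) := by
  -- With discrete fibres the bundle is a covering space, and its continuous sections are the
  -- locally transported families.
  let : TopologicalSpace V := ⊥
  have : DiscreteTopology V := ⟨rfl⟩
  let Z : FiberBundleCore X X V :=
    { baseSet := U
      isOpen_baseSet := hU
      indexAt := id
      mem_baseSet_at := hi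
      -- A fibre coordinate in the chart i is the value transported back to the base point i; it is
      -- moved from i to b inside U i, then from b to j inside U j.
      coordChange := fun i j b v ↦ T j b j (T i i b v)
      coordChange_self := fun i x hx v ↦ by
        rw [hT_comp i i (hi i) x hx i (hi i), hT_self i i (hi i)]
      -- V being discrete, continuity means that the coordinate change is locally constant in b,
      -- which follows from the agreement of the two transports near b.
      continuousOn_coordChange := by
        rintro i j ⟨b, v⟩ ⟨hb, -⟩
        refine ContinuousAt.continuousWithinAt ?_
        rw [ContinuousAt, nhds_prod_eq, nhds_discrete V, tendsto_pure,
          prod_pure, eventually_map]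
        filter_upwards [hT_compat i j b hb (T i i b v), (hU i).mem_nhds hb.1,
          (hU j).mem_nhds hb.2] with b' h1 h2 h3
        rw [← hT_comp i i (hi i) b hb.1 b' h2, ← h1, hT_comp j b hb.2 b' h3 j (hi j)]
      coordChange_comp := fun i j k x hx v ↦ by
        rw [hT_comp j x hx.1.2 j (hi j) x hx.1.2, hT_self j x hx.1.2] }
  have hcov : IsCoveringMap (Bundle.TotalSpace.proj : Bundle.TotalSpace V Z.Fiber → X) :=
    FiberBundle.isCoveringMap
  -- Simple connectedness is used here: the identity of X lifts through the covering.
  obtain ⟨σ, ⟨hσ0, hσ⟩, -⟩ := hcov.existsUnique_continuousMap_lifts (ContinuousMap.id X) x₀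
    ⟨x₀, v₀⟩ rfl
  have hproj : ∀ b, (σ b).1 = b := fun b ↦ congrFun hσ b
  let sec : ∀ e : Bundle.TotalSpace V Z.Fiber, V := fun e ↦ e.2
  refine ⟨fun b ↦ sec (σ b), ?_, fun i ↦ ?_⟩
  · simp only [hσ0, sec]
  -- Continuity into a discrete space makes the fibre coordinate constant near i; undoing the
  -- transport from b back to i gives the claim.
  · have hc : ContinuousAt (fun b ↦ (Z.localTriv i (σ b)).2) i := by
      have h1 : ContinuousAt (Z.localTriv i) (σ i) :=
        (Z.localTriv i).continuousAt (by
          rw [FiberBundleCore.mem_localTriv_source, hproj]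
          exact hi i)
      exact (h1.comp σ.continuous.continuousAt).snd
    rw [ContinuousAt, nhds_discrete V, tendsto_pure] at hc
    have hval : ∀ b ∈ U i, (Z.localTriv i (σ b)).2 = T i b i (sec (σ b)) := by
      intro b hb
      rw [FiberBundleCore.localTriv_apply]
      change T i (σ b).1 i (T (σ b).1 (σ b).1 (σ b).1 (sec (σ b))) = _
      rw [hT_self _ _ (hi _), hproj]
    filter_upwards [hc, (hU i).mem_nhds (hi i)] with b h1 h2
    rw [hval b h2, hval i (hi i), hT_self i i (hi i)] at h1
    rw [← h1, hT_comp i b h2 i (hi i) b h2, hT_self i b h2]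

/-! ### Vector fields and functions in the preferred charts -/

section Coordinates

variable {m : ℕ} {M : Type*} [TopologicalSpace M]
  [ChartedSpace (EuclideanSpace ℝ (Fin m)) M] [IsManifold (𝓡 m) ∞ M]

instance : IsManifold (𝓡 m) 2 M := IsManifold.of_le (n := ∞) (by norm_cast)

/-- The components of a tangent vector at `q` in the preferred chart at `p`. -/
def coordMap (p q : M) : TangentSpace (𝓡 m) q →L[ℝ] EuclideanSpace ℝ (Fin m) :=
  (trivializationAt (EuclideanSpace ℝ (Fin m)) (TangentSpace (𝓡 m)) p).continuousLinearMapAt ℝ q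

/-- The tangent vector at `q` with given components in the preferred chart at `p`. -/
def frameMap (p q : M) : EuclideanSpace ℝ (Fin m) →L[ℝ] TangentSpace (𝓡 m) q :=
  (trivializationAt (EuclideanSpace ℝ (Fin m)) (TangentSpace (𝓡 m)) p).symmL ℝ q

/-- The vector field with constant components `w` in the preferred chart at `p`. -/
def frame (p : M) (w : EuclideanSpace ℝ (Fin m)) (q : M) : TangentSpace (𝓡 m) q :=
  frameMap p q w

/-- The components of a vector field in the preferred chart at `p`. -/
def coordRep (p : M) (Y : Π q : M, TangentSpace (𝓡 m) q) (q : M) : EuclideanSpace ℝ (Fin m) :=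
  coordMap p q (Y q)

variable {p q : M}

theorem coordMap_frameMap (hq : q ∈ (chartAt (EuclideanSpace ℝ (Fin m)) p).source)
    (w : EuclideanSpace ℝ (Fin m)) : coordMap p q (frameMap p q w) = w :=
  Bundle.Trivialization.continuousLinearMapAt_symmL _ hq w

theorem frameMap_coordMap (hq : q ∈ (chartAt (EuclideanSpace ℝ (Fin m)) p).source)
    (u : TangentSpace (𝓡 m) q) : frameMap p q (coordMap p q u) = u :=
  Bundle.Trivialization.symmL_continuousLinearMapAt _ hq u

theorem coordMap_eq_mfderiv (hq : q ∈ (chartAt (EuclideanSpace ℝ (Fin m)) p).source) :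
    coordMap p q = mfderiv (𝓡 m) (𝓡 m) (chartAt (EuclideanSpace ℝ (Fin m)) p) q := by
  rw [mfderiv_chartAt_eq_tangentCoordChange hq]
  exact TangentBundle.continuousLinearMapAt_trivializationAt_eq_core hq

theorem coordMap_self (p : M) (u : TangentSpace (𝓡 m) p) : coordMap p p u = u := by
  have h := mem_chart_source (EuclideanSpace ℝ (Fin m)) p
  rw [coordMap, TangentBundle.continuousLinearMapAt_trivializationAt_eq_core h]
  exact tangentCoordChange_self (by rwa [extChartAt_source])

theorem extend_eq_frame (hq : q ∈ (chartAt (EuclideanSpace ℝ (Fin m)) p).source)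
    (u : TangentSpace (𝓡 m) p) :
    FiberBundle.extend (EuclideanSpace ℝ (Fin m)) u q = frame p (coordMap p p u) q := by
  have h := mem_chart_source (EuclideanSpace ℝ (Fin m)) p
  simp only [FiberBundle.extend, frame, frameMap, coordMap]
  rw [Bundle.Trivialization.continuousLinearMapAt_apply,
    Bundle.Trivialization.coe_linearMapAt_of_mem _ h]
  exact (Bundle.Trivialization.symmL_apply (R := ℝ) _ hq _).symm

theorem coordRep_eventuallyEq (hq : q ∈ (chartAt (EuclideanSpace ℝ (Fin m)) p).source)
    (Y : Π q : M, TangentSpace (𝓡 m) q) :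
    coordRep p Y =ᶠ[𝓝 q] fun q' ↦
      (trivializationAt (EuclideanSpace ℝ (Fin m)) (TangentSpace (𝓡 m)) p ⟨q', Y q'⟩).2 := by
  filter_upwards [(chartAt (EuclideanSpace ℝ (Fin m)) p).open_source.mem_nhds hq] with q' hq'
  rw [coordRep, coordMap, Bundle.Trivialization.continuousLinearMapAt_apply,
    Bundle.Trivialization.coe_linearMapAt_of_mem _ hq']

theorem mdifferentiableAt_field_iff (hq : q ∈ (chartAt (EuclideanSpace ℝ (Fin m)) p).source)
    (Y : Π q : M, TangentSpace (𝓡 m) q) :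
    MDifferentiableAt (𝓡 m) (𝓡 m).tangent (fun y ↦ (⟨y, Y y⟩ : TangentBundle (𝓡 m) M)) q ↔
      MDifferentiableAt (𝓡 m) 𝓘(ℝ, EuclideanSpace ℝ (Fin m)) (coordRep p Y) q := by
  rw [(coordRep_eventuallyEq hq Y).mdifferentiableAt_iff]
  exact Bundle.Trivialization.mdifferentiableAt_section_iff (𝓡 m)
    (trivializationAt (EuclideanSpace ℝ (Fin m)) (TangentSpace (𝓡 m)) p) Y hq

theorem contMDiffAt_field_iff (hq : q ∈ (chartAt (EuclideanSpace ℝ (Fin m)) p).source)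
    (Y : Π q : M, TangentSpace (𝓡 m) q) :
    ContMDiffAt (𝓡 m) (𝓡 m).tangent ∞ (fun y ↦ (⟨y, Y y⟩ : TangentBundle (𝓡 m) M)) q ↔
      ContMDiffAt (𝓡 m) 𝓘(ℝ, EuclideanSpace ℝ (Fin m)) ∞ (coordRep p Y) q := by
  rw [(coordRep_eventuallyEq hq Y).contMDiffAt_iff]
  exact Bundle.Trivialization.contMDiffAt_section_iff
    (trivializationAt (EuclideanSpace ℝ (Fin m)) (TangentSpace (𝓡 m)) p) hq

theorem coordRep_frame_eventuallyEq (hq : q ∈ (chartAt (EuclideanSpace ℝ (Fin m)) p).source)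
    (w : EuclideanSpace ℝ (Fin m)) : coordRep p (frame p w) =ᶠ[𝓝 q] fun _ ↦ w := by
  filter_upwards [(chartAt (EuclideanSpace ℝ (Fin m)) p).open_source.mem_nhds hq] with q' hq'
  exact coordMap_frameMap hq' w

theorem contMDiffAt_frame (hq : q ∈ (chartAt (EuclideanSpace ℝ (Fin m)) p).source)
    (w : EuclideanSpace ℝ (Fin m)) :
    ContMDiffAt (𝓡 m) (𝓡 m).tangent ∞
      (fun y ↦ (⟨y, frame p w y⟩ : TangentBundle (𝓡 m) M)) q := by
  rw [contMDiffAt_field_iff hq, (coordRep_frame_eventuallyEq hq w).contMDiffAt_iff]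
  exact contMDiffAt_const

theorem mdifferentiableAt_frame (hq : q ∈ (chartAt (EuclideanSpace ℝ (Fin m)) p).source)
    (w : EuclideanSpace ℝ (Fin m)) :
    MDifferentiableAt (𝓡 m) (𝓡 m).tangent
      (fun y ↦ (⟨y, frame p w y⟩ : TangentBundle (𝓡 m) M)) q :=
  (contMDiffAt_frame hq w).mdifferentiableAt (by simp)

section Functions

variable {F : Type*} [NormedAddCommGroup F] [NormedSpace ℝ F]

theorem contMDiffAt_iff_comp_symm {x : OpenPartialHomeomorph M (EuclideanSpace ℝ (Fin m))}
    (hx : x ∈ IsManifold.maximalAtlas (𝓡 m) ∞ M) (hq : q ∈ x.source) (f : M → F) :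
    ContMDiffAt (𝓡 m) 𝓘(ℝ, F) ∞ f q ↔ ContDiffAt ℝ ∞ (f ∘ x.symm) (x q) := by
  rw [← contMDiffAt_iff_contDiffAt]
  constructor
  · intro h
    have h1 := contMDiffAt_symm_of_mem_maximalAtlas hx (x.map_source hq)
    refine ContMDiffAt.comp (x q) ?_ h1
    rwa [x.left_inv hq]
  · intro h
    have h1 := contMDiffAt_of_mem_maximalAtlas hx hq
    refine (h.comp q h1).congr_of_eventuallyEq ?_
    filter_upwards [x.open_source.mem_nhds hq] with y hy
    simp [x.left_inv hy]

theorem mdifferentiableAt_iff_comp_symm {x : OpenPartialHomeomorph M (EuclideanSpace ℝ (Fin m))}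
    (hx : x ∈ IsManifold.maximalAtlas (𝓡 m) ∞ M) (hq : q ∈ x.source) (f : M → F) :
    MDifferentiableAt (𝓡 m) 𝓘(ℝ, F) f q ↔ DifferentiableAt ℝ (f ∘ x.symm) (x q) := by
  rw [← mdifferentiableAt_iff_differentiableAt]
  constructor
  · intro h
    have h1 := (contMDiffAt_symm_of_mem_maximalAtlas hx (x.map_source hq)).mdifferentiableAt
      (by simp)
    refine MDifferentiableAt.comp (x q) ?_ h1
    rwa [x.left_inv hq]
  · intro h
    have h1 := (contMDiffAt_of_mem_maximalAtlas hx hq).mdifferentiableAt (by simp)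
    refine (h.comp q h1).congr_of_eventuallyEq ?_
    filter_upwards [x.open_source.mem_nhds hq] with y hy
    simp [x.left_inv hy]

theorem mvfderiv_eq_fderiv_comp_symm
    {x : OpenPartialHomeomorph M (EuclideanSpace ℝ (Fin m))}
    (hx : x ∈ IsManifold.maximalAtlas (𝓡 m) ∞ M) (hq : q ∈ x.source) {f : M → F}
    (hf : MDifferentiableAt (𝓡 m) 𝓘(ℝ, F) f q) (u : TangentSpace (𝓡 m) q) :
    mvfderiv (𝓡 m) f q u = fderiv ℝ (f ∘ x.symm) (x q) (mfderiv (𝓡 m) (𝓡 m) x q u) := by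
  have h1 := (contMDiffAt_of_mem_maximalAtlas hx hq).mdifferentiableAt (by simp)
  have h2 := (mdifferentiableAt_iff_comp_symm hx hq f).1 hf
  have h3 : f =ᶠ[𝓝 q] (f ∘ x.symm) ∘ x := by
    filter_upwards [x.open_source.mem_nhds hq] with y hy
    simp [x.left_inv hy]
  have h4 : mfderiv (𝓡 m) 𝓘(ℝ, F) f q =
      (mfderiv 𝓘(ℝ, EuclideanSpace ℝ (Fin m)) 𝓘(ℝ, F) (f ∘ x.symm) (x q)).comp
        (mfderiv (𝓡 m) (𝓡 m) x q) := by
    have h5 := mfderiv_comp (I := 𝓡 m) q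
      (mdifferentiableAt_iff_differentiableAt.2 h2) h1
    rw [← h5]
    exact h3.mfderiv_eq
  rw [mfderiv_eq_fderiv] at h4
  exact congr($h4 u)

theorem mvfderiv_eq_fderiv_coordMap (hq : q ∈ (chartAt (EuclideanSpace ℝ (Fin m)) p).source)
    {f : M → F} (hf : MDifferentiableAt (𝓡 m) 𝓘(ℝ, F) f q) (u : TangentSpace (𝓡 m) q) :
    mvfderiv (𝓡 m) f q u = fderiv ℝ (f ∘ (chartAt (EuclideanSpace ℝ (Fin m)) p).symm)
      (chartAt (EuclideanSpace ℝ (Fin m)) p q) (coordMap p q u) := by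
  rw [mvfderiv_eq_fderiv_comp_symm (IsManifold.chart_mem_maximalAtlas p) hq hf,
    coordMap_eq_mfderiv hq]
  rfl

theorem mvfderiv_congr {f g : M → F} (h : f =ᶠ[𝓝 q] g) :
    mvfderiv (𝓡 m) f q = mvfderiv (𝓡 m) g q := by
  ext u
  have := congr($(h.mfderiv_eq (I := 𝓡 m) (I' := 𝓘(ℝ, F))) u)
  exact this

end Functions

end Coordinates

/-! ### Christoffel symbols and their smoothness -/

section Christoffel

variable {m : ℕ} {M : Type*} [TopologicalSpace M]
  [ChartedSpace (EuclideanSpace ℝ (Fin m)) M] [IsManifold (𝓡 m) ∞ M]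

/-- A bump function supported in the chart domain and equal to 1 near q cuts the frame field off.
Flatness and the solution space are tested on globally smooth fields only, so coordinate identities
are extracted through these extensions. -/
theorem exists_smoothField_eq_frame [T2Space M] {p q : M}
    (hq : q ∈ (chartAt (EuclideanSpace ℝ (Fin m)) p).source) (w : EuclideanSpace ℝ (Fin m)) :
    ∃ X : Π q : M, TangentSpace (𝓡 m) q, IsSmoothField X ∧ X =ᶠ[𝓝 q] frame p w := by
  have hs := (chartAt (EuclideanSpace ℝ (Fin m)) p).open_source.mem_nhds hq
  obtain ⟨f, hf, -⟩ := (SmoothBumpFunction.nhds_basis_support (I := 𝓡 m) hs).mem_iff.1 hs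
  refine ⟨(f : M → ℝ) • frame p w, ?_, ?_⟩
  · exact ContMDiffOn.smul_section_of_tsupport (n := ∞) f.contMDiff.contMDiffOn
      (chartAt (EuclideanSpace ℝ (Fin m)) p).open_source hf
      fun y hy ↦ (contMDiffAt_frame hy w).contMDiffWithinAt
  · filter_upwards [f.eventuallyEq_one] with y hy
    simp only [Pi.smul_apply', hy, Pi.one_apply, one_smul]
    rfl

/-- The constant vector field on `ℝᵐ`. -/
def constField (w : EuclideanSpace ℝ (Fin m)) (z : EuclideanSpace ℝ (Fin m)) :
    TangentSpace (𝓡 m) z :=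
  w

theorem mdifferentiableAt_constField (w y : EuclideanSpace ℝ (Fin m)) :
    MDifferentiableAt (𝓡 m) (𝓡 m).tangent (fun z ↦ (⟨z, constField w z⟩ :
      TangentBundle (𝓡 m) (EuclideanSpace ℝ (Fin m)))) y := by
  have : ContMDiffAt (𝓡 m) (𝓡 m).tangent ∞ (fun z ↦ (⟨z, constField w z⟩ :
      TangentBundle (𝓡 m) (EuclideanSpace ℝ (Fin m)))) y :=
    contMDiffAt_vectorSpace_iff_contDiffAt.2 contDiffAt_const
  exact this.mdifferentiableAt (by simp)

/-- The bracket of coordinate fields vanishes. -/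
theorem mlieBracket_frame {p q : M}
    (hq : q ∈ (chartAt (EuclideanSpace ℝ (Fin m)) p).source) (a b : EuclideanSpace ℝ (Fin m)) :
    VectorField.mlieBracket (𝓡 m) (frame p a) (frame p b) q = 0 := by
  -- Coordinate fields are pull-backs of constant fields by the chart, and the bracket commutes with
  -- pull-back.
  have h : ∀ w : EuclideanSpace ℝ (Fin m), frame p w =ᶠ[𝓝 q]
      VectorField.mpullback (𝓡 m) (𝓡 m) (chartAt (EuclideanSpace ℝ (Fin m)) p)
        (constField w) := by
    intro w
    filter_upwards [(chartAt (EuclideanSpace ℝ (Fin m)) p).open_source.mem_nhds hq] with y hy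
    have h1 : (mfderiv (𝓡 m) (𝓡 m) (chartAt (EuclideanSpace ℝ (Fin m)) p) y).inverse =
        frameMap p y := by
      rw [← coordMap_eq_mfderiv hy]
      exact ContinuousLinearMap.inverse_eq (by ext1 v; exact coordMap_frameMap hy v)
        (by ext1 v; exact frameMap_coordMap hy v)
    exact congr($h1 w).symm
  have : IsManifold (𝓡 m) (minSmoothness ℝ 2) M := by
    rw [minSmoothness_of_isRCLikeNormedField]
    infer_instance
  have hbr : VectorField.mlieBracket (𝓡 m) (constField a) (constField b) = 0 := by
    refine VectorField.mlieBracketWithin_eq_lieBracketWithin.trans ?_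
    ext1 z
    change fderivWithin ℝ (fun _ : EuclideanSpace ℝ (Fin m) ↦ b) univ z a -
      fderivWithin ℝ (fun _ : EuclideanSpace ℝ (Fin m) ↦ a) univ z b = 0
    simp
  rw [(h a).mlieBracket_vectorField_eq (h b),
    ← VectorField.mpullback_mlieBracket (n := ∞) (mdifferentiableAt_constField a _)
      (mdifferentiableAt_constField b _)
      (contMDiffAt_of_mem_maximalAtlas (IsManifold.chart_mem_maximalAtlas p) hq)
      (by rw [minSmoothness_of_isRCLikeNormedField]; norm_cast), hbr, VectorField.mpullback_zero]
  rfl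

/-- The map `a ↦ ∇_a e_b` in the preferred chart at `p`. -/
def covFrame (cov : Connection m M) (p : M) (b : EuclideanSpace ℝ (Fin m)) (q : M) :
    EuclideanSpace ℝ (Fin m) →L[ℝ] EuclideanSpace ℝ (Fin m) :=
  (coordMap p q).comp ((cov (frame p b) q).comp (frameMap p q))

/-- The Christoffel symbols in the preferred chart at `p`, as a function of the coordinates:
`christoffel cov p y a b` has the components of `∇_a e_b`. -/
def christoffel (cov : Connection m M) (p : M) (y : EuclideanSpace ℝ (Fin m)) :
    EuclideanSpace ℝ (Fin m) →L[ℝ] EuclideanSpace ℝ (Fin m) →L[ℝ] EuclideanSpace ℝ (Fin m) :=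
  -- Linearity in b is built in by summing over the standard basis; agreement with the covariant
  -- derivative for arbitrary constant b is `coordMap_cov_frame`.
  ContinuousLinearMap.flip (∑ j, (EuclideanSpace.proj j : EuclideanSpace ℝ (Fin m) →L[ℝ] ℝ).smulRight
    (covFrame cov p (EuclideanSpace.single j 1)
      ((chartAt (EuclideanSpace ℝ (Fin m)) p).symm y)))

theorem christoffel_single (cov : Connection m M) (p : M) (y a : EuclideanSpace ℝ (Fin m))
    (j : Fin m) : christoffel cov p y a (EuclideanSpace.single j 1) =
      covFrame cov p (EuclideanSpace.single j 1)
        ((chartAt (EuclideanSpace ℝ (Fin m)) p).symm y) a := by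
  simp [christoffel, PiLp.single_apply]

theorem cov_congr (cov : Connection m M) {q : M} {Y Y' : Π q : M, TangentSpace (𝓡 m) q}
    (hY : MDifferentiableAt (𝓡 m) (𝓡 m).tangent (fun y ↦ (⟨y, Y y⟩ : TangentBundle (𝓡 m) M)) q)
    (hY' : MDifferentiableAt (𝓡 m) (𝓡 m).tangent (fun y ↦ (⟨y, Y' y⟩ : TangentBundle (𝓡 m) M)) q)
    (h : Y =ᶠ[𝓝 q] Y') : cov Y q = cov Y' q :=
  cov.isCovariantDerivativeOnUniv.congr_of_eventuallyEq hY hY' univ_mem h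

/-- A covariant derivative in coordinates. -/
theorem coordMap_cov (cov : Connection m M) {p q : M}
    (hq : q ∈ (chartAt (EuclideanSpace ℝ (Fin m)) p).source) {Y : Π q : M, TangentSpace (𝓡 m) q}
    (hY : MDifferentiableAt (𝓡 m) (𝓡 m).tangent (fun y ↦ (⟨y, Y y⟩ : TangentBundle (𝓡 m) M)) q)
    (u : TangentSpace (𝓡 m) q) :
    coordMap p q (cov Y q u) = mvfderiv (𝓡 m) (coordRep p Y) q u +
      christoffel cov p (chartAt (EuclideanSpace ℝ (Fin m)) p q) (coordMap p q u)
        (coordRep p Y q) := by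
  -- In the difference Φ of the two sides the derivative terms of the Leibniz rules cancel. So Φ is
  -- tensorial and need only be evaluated on the coordinate frame, where it vanishes by construction
  -- of the symbols.
  set Φ : (Π q : M, TangentSpace (𝓡 m) q) → EuclideanSpace ℝ (Fin m) := fun Y ↦
    coordMap p q (cov Y q u) - (mvfderiv (𝓡 m) (coordRep p Y) q u +
      christoffel cov p (chartAt (EuclideanSpace ℝ (Fin m)) p q) (coordMap p q u)
        (coordRep p Y q)) with hΦdef
  have hΦ : TensorialAt (𝓡 m) (EuclideanSpace ℝ (Fin m)) Φ q := by
    refine ⟨fun {f σ} hf hσ ↦ ?_, fun {σ σ'} hσ hσ' ↦ ?_⟩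
    · have e : coordRep p (f • σ) = f • coordRep p σ := by
        ext1 y
        exact map_smul (coordMap p y) (f y) (σ y)
      have e2 : mvfderiv (𝓡 m) (f • coordRep p σ) q u =
          f q • mvfderiv (𝓡 m) (coordRep p σ) q u +
            mvfderiv (𝓡 m) f q u • coordRep p σ q := by
        rw [mvfderiv_smul hf ((mdifferentiableAt_field_iff hq σ).1 hσ)]
        simp
      simp only [hΦdef, e, e2, cov.isCovariantDerivativeOnUniv.leibniz hσ hf, Pi.smul_apply',
        coordRep, add_apply, smul_apply, map_add, map_smul,
        ContinuousLinearMap.smulRight_apply]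
      module
    · have e : coordRep p (σ + σ') = coordRep p σ + coordRep p σ' := by
        ext1 y
        exact map_add (coordMap p y) (σ y) (σ' y)
      simp only [hΦdef, e, cov.isCovariantDerivativeOnUniv.add hσ hσ',
        mvfderiv_add ((mdifferentiableAt_field_iff hq σ).1 hσ)
          ((mdifferentiableAt_field_iff hq σ').1 hσ'), Pi.add_apply, add_apply, map_add]
      module
  have hL : ∀ w : EuclideanSpace ℝ (Fin m), TensorialAt.mkHom Φ q hΦ (frameMap p q w) = 0 := by
    have h0 : (TensorialAt.mkHom Φ q hΦ).comp (frameMap p q) = 0 := by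
      refine ContinuousLinearMap.coe_injective
        ((EuclideanSpace.basisFun (Fin m) ℝ).toBasis.ext fun j ↦ ?_)
      have h1 : TensorialAt.mkHom Φ q hΦ (frame p (EuclideanSpace.single j 1) q) =
          Φ (frame p (EuclideanSpace.single j 1)) := TensorialAt.mkHom_apply hΦ
        (mdifferentiableAt_frame hq (EuclideanSpace.single j 1))
      have hrep := coordRep_frame_eventuallyEq hq (EuclideanSpace.single j (1 : ℝ))
      have h2 : Φ (frame p (EuclideanSpace.single j 1)) = 0 := by
        simp only [hΦdef]
        rw [mvfderiv_congr hrep, hrep.eq_of_nhds, christoffel_single, mvfderiv_const,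
          (chartAt (EuclideanSpace ℝ (Fin m)) p).left_inv hq]
        simp [covFrame, frameMap_coordMap hq]
      rw [h2] at h1
      simpa [frame] using h1
    exact fun w ↦ congr($h0 w)
  have h3 : TensorialAt.mkHom Φ q hΦ (Y q) = Φ Y := TensorialAt.mkHom_apply hΦ hY
  rw [← frameMap_coordMap hq (Y q), hL] at h3
  exact sub_eq_zero.1 h3.symm

theorem coordMap_cov_frame (cov : Connection m M) {p q : M}
    (hq : q ∈ (chartAt (EuclideanSpace ℝ (Fin m)) p).source) (b : EuclideanSpace ℝ (Fin m))
    (u : TangentSpace (𝓡 m) q) :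
    coordMap p q (cov (frame p b) q u) =
      christoffel cov p (chartAt (EuclideanSpace ℝ (Fin m)) p q) (coordMap p q u) b := by
  have hrep := coordRep_frame_eventuallyEq hq b
  rw [coordMap_cov cov hq (mdifferentiableAt_frame hq b), mvfderiv_congr hrep, hrep.eq_of_nhds,
    mvfderiv_const]
  simp

/-- Near each point a coordinate field agrees with a global smooth field, whose covariant derivative
is a smooth section of the endomorphism bundle; the symbols are its components in the chart at p. -/
theorem contDiffOn_christoffel [T2Space M] {cov : Connection m M}
    (hcov : CovariantDerivative.ContMDiffCovariantDerivative cov ∞) (p : M) :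
    ContDiffOn ℝ ∞ (christoffel cov p) (chartAt (EuclideanSpace ℝ (Fin m)) p).target := by
  intro y hy
  refine ContDiffAt.contDiffWithinAt ?_
  set q := (chartAt (EuclideanSpace ℝ (Fin m)) p).symm y with hqdef
  have hq : q ∈ (chartAt (EuclideanSpace ℝ (Fin m)) p).source :=
    (chartAt (EuclideanSpace ℝ (Fin m)) p).map_target hy
  have key : ∀ j : Fin m, ContDiffAt ℝ ∞
      (covFrame cov p (EuclideanSpace.single j 1) ∘
        (chartAt (EuclideanSpace ℝ (Fin m)) p).symm) y := by
    intro j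
    have hyq : y = chartAt (EuclideanSpace ℝ (Fin m)) p q :=
      ((chartAt (EuclideanSpace ℝ (Fin m)) p).right_inv hy).symm
    rw [hyq, ← contMDiffAt_iff_comp_symm (IsManifold.chart_mem_maximalAtlas p) hq]
    obtain ⟨X, hX, hXe⟩ := exists_smoothField_eq_frame hq (EuclideanSpace.single j (1 : ℝ))
    have h1 := hcov.contMDiff.contMDiff (σ := X) (by
      rw [contMDiffOn_univ]
      exact hX)
    have h2 := (contMDiffOn_univ.1 h1).contMDiffAt (x := q)
    have h3 := (Bundle.Trivialization.contMDiffAt_section_iff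
      (trivializationAt (EuclideanSpace ℝ (Fin m) →L[ℝ] EuclideanSpace ℝ (Fin m))
        (fun x : M ↦ TangentSpace (𝓡 m) x →L[ℝ] TangentSpace (𝓡 m) x) p) (⟨hq, hq⟩)).1 h2
    refine h3.congr_of_eventuallyEq ?_
    filter_upwards [hXe.eventuallyEq_nhds,
      (chartAt (EuclideanSpace ℝ (Fin m)) p).open_source.mem_nhds hq] with y hy1 hy2
    have h4 : cov X y = cov (frame p (EuclideanSpace.single j 1)) y :=
      cov_congr cov ((hX y).mdifferentiableAt (by simp)) (mdifferentiableAt_frame hy2 _) hy1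
    change covFrame cov p _ y = (coordMap p y).comp ((cov X y).comp (frameMap p y))
    rw [h4]
    rfl
  have : christoffel cov p = fun y ↦ ContinuousLinearMap.flipₗᵢ ℝ _ _ _
      (∑ j, ContinuousLinearMap.smulRightL ℝ _ _
        (EuclideanSpace.proj j : EuclideanSpace ℝ (Fin m) →L[ℝ] ℝ)
      ((covFrame cov p (EuclideanSpace.single j 1) ∘
        (chartAt (EuclideanSpace ℝ (Fin m)) p).symm) y)) := rfl
  rw [this]
  refine (ContinuousLinearMap.flipₗᵢ ℝ (EuclideanSpace ℝ (Fin m)) (EuclideanSpace ℝ (Fin m))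
    (EuclideanSpace ℝ (Fin m))).contDiff.contDiffAt.comp y
    (ContDiffAt.sum fun j _ ↦ ?_)
  exact (ContinuousLinearMap.contDiff _).contDiffAt.comp y (key j)

end Christoffel

/-! ### Curvature in coordinates and under projective change -/

section Curvature

variable {m : ℕ} {M : Type*} [TopologicalSpace M]
  [ChartedSpace (EuclideanSpace ℝ (Fin m)) M] [IsManifold (𝓡 m) ∞ M]

/-- The curvature of the connection on `E` with Christoffel symbols `Γ`. -/
def riemann {E : Type*} [NormedAddCommGroup E] [NormedSpace ℝ E] (Γ : E → E →L[ℝ] E →L[ℝ] E)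
    (y a b c : E) : E :=
  fderiv ℝ Γ y a b c - fderiv ℝ Γ y b a c + Γ y a (Γ y b c) - Γ y b (Γ y a c)

theorem mdifferentiableAt_of_eventuallyEq_frame {p q : M}
    (hq : q ∈ (chartAt (EuclideanSpace ℝ (Fin m)) p).source) {w : EuclideanSpace ℝ (Fin m)}
    {X : Π q : M, TangentSpace (𝓡 m) q} (hX : X =ᶠ[𝓝 q] frame p w) :
    MDifferentiableAt (𝓡 m) (𝓡 m).tangent (fun y ↦ (⟨y, X y⟩ : TangentBundle (𝓡 m) M)) q :=
  (mdifferentiableAt_frame hq w).congr_of_eventuallyEq (hX.mono fun y hy ↦ by simp only [hy])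

theorem coordRep_cov_eventuallyEq (cov : Connection m M) {p q : M}
    (hq : q ∈ (chartAt (EuclideanSpace ℝ (Fin m)) p).source) {b c : EuclideanSpace ℝ (Fin m)}
    {Y Z : Π q : M, TangentSpace (𝓡 m) q} (hY : Y =ᶠ[𝓝 q] frame p b)
    (hZ : Z =ᶠ[𝓝 q] frame p c) :
    coordRep p (fun q ↦ cov Z q (Y q)) =ᶠ[𝓝 q] fun q' ↦
      christoffel cov p (chartAt (EuclideanSpace ℝ (Fin m)) p q') b c := by
  filter_upwards [hY, hZ.eventuallyEq_nhds,
    (chartAt (EuclideanSpace ℝ (Fin m)) p).open_source.mem_nhds hq] with q' h1 h2 h3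
  rw [coordRep, cov_congr cov (mdifferentiableAt_of_eventuallyEq_frame h3 h2)
    (mdifferentiableAt_frame h3 c) h2, coordMap_cov_frame cov h3, h1, frame, coordMap_frameMap h3]

/-- The bracket term drops out for coordinate fields, leaving two iterated derivatives. Only germs
at q are compared, so this serves both cut-off frames and the extensions defining `curvatureTensor`.
-/
theorem coordMap_curvature {cov : Connection m M} {p q : M}
    (hq : q ∈ (chartAt (EuclideanSpace ℝ (Fin m)) p).source)
    (hΓ : DifferentiableAt ℝ (christoffel cov p) (chartAt (EuclideanSpace ℝ (Fin m)) p q))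
    {a b c : EuclideanSpace ℝ (Fin m)} {X Y Z : Π q : M, TangentSpace (𝓡 m) q}
    (hX : X =ᶠ[𝓝 q] frame p a) (hY : Y =ᶠ[𝓝 q] frame p b) (hZ : Z =ᶠ[𝓝 q] frame p c) :
    coordMap p q (curvature cov X Y Z q) =
      riemann (christoffel cov p) (chartAt (EuclideanSpace ℝ (Fin m)) p q) a b c := by
  have key : ∀ (b : EuclideanSpace ℝ (Fin m)) (Y : Π q : M, TangentSpace (𝓡 m) q),
      Y =ᶠ[𝓝 q] frame p b → ∀ u : TangentSpace (𝓡 m) q,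
      coordMap p q (cov (fun q ↦ cov Z q (Y q)) q u) =
        fderiv ℝ (christoffel cov p) (chartAt (EuclideanSpace ℝ (Fin m)) p q)
          (coordMap p q u) b c +
        christoffel cov p (chartAt (EuclideanSpace ℝ (Fin m)) p q) (coordMap p q u)
          (christoffel cov p (chartAt (EuclideanSpace ℝ (Fin m)) p q) b c) := by
    intro b Y hY u
    have hrep := coordRep_cov_eventuallyEq cov hq hY hZ
    have hcomp : (fun q' ↦ christoffel cov p (chartAt (EuclideanSpace ℝ (Fin m)) p q') b c) ∘
        (chartAt (EuclideanSpace ℝ (Fin m)) p).symm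
        =ᶠ[𝓝 (chartAt (EuclideanSpace ℝ (Fin m)) p q)] fun y ↦ christoffel cov p y b c := by
      filter_upwards [(chartAt (EuclideanSpace ℝ (Fin m)) p).open_target.mem_nhds
        ((chartAt (EuclideanSpace ℝ (Fin m)) p).map_source hq)] with y hy
      simp [(chartAt (EuclideanSpace ℝ (Fin m)) p).right_inv hy]
    have hd : HasFDerivAt (fun y ↦ christoffel cov p y b c)
        (((fderiv ℝ (christoffel cov p)
          (chartAt (EuclideanSpace ℝ (Fin m)) p q)).flip b).flip c)
        (chartAt (EuclideanSpace ℝ (Fin m)) p q) := by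
      have := (hΓ.hasFDerivAt.clm_apply (hasFDerivAt_const b _)).clm_apply (hasFDerivAt_const c _)
      refine this.congr_fderiv ?_
      ext v
      simp
    have hmd : MDifferentiableAt (𝓡 m) 𝓘(ℝ, EuclideanSpace ℝ (Fin m))
        (fun q' ↦ christoffel cov p (chartAt (EuclideanSpace ℝ (Fin m)) p q') b c) q :=
      (mdifferentiableAt_iff_comp_symm (IsManifold.chart_mem_maximalAtlas p) hq _).2
        (hd.differentiableAt.congr_of_eventuallyEq hcomp)
    rw [coordMap_cov cov hq ((mdifferentiableAt_field_iff hq _).2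
      (hmd.congr_of_eventuallyEq hrep)), mvfderiv_congr hrep, hrep.eq_of_nhds,
      mvfderiv_eq_fderiv_coordMap hq hmd, hcomp.fderiv_eq, hd.fderiv]
    simp
  have hbr : VectorField.mlieBracket (𝓡 m) X Y q = 0 := by
    rw [hX.mlieBracket_vectorField_eq hY, mlieBracket_frame hq]
  rw [curvature, hbr, map_zero, sub_zero, map_sub, key b Y hY, key a X hX, hX.eq_of_nhds,
    hY.eq_of_nhds, frame, frame, coordMap_frameMap hq, coordMap_frameMap hq, riemann]
  abel

/-- Coordinate fields commute, so on them the torsion is the antisymmetric part of the symbols. -/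
theorem christoffel_symm {cov : Connection m M} (hcov : cov.torsion = 0) {p : M}
    {y : EuclideanSpace ℝ (Fin m)} (hy : y ∈ (chartAt (EuclideanSpace ℝ (Fin m)) p).target)
    (a b : EuclideanSpace ℝ (Fin m)) :
    christoffel cov p y a b = christoffel cov p y b a := by
  have hq := (chartAt (EuclideanSpace ℝ (Fin m)) p).map_target hy
  have h := cov.torsion_eq_zero_iff.1 hcov (mdifferentiableAt_frame hq a)
    (mdifferentiableAt_frame hq b)
  rw [mlieBracket_frame hq, sub_eq_zero] at h
  have h2 := congrArg (coordMap p _) h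
  rwa [coordMap_cov_frame cov hq, coordMap_cov_frame cov hq, frame, frame, coordMap_frameMap hq,
    coordMap_frameMap hq, (chartAt (EuclideanSpace ℝ (Fin m)) p).right_inv hy] at h2

theorem riemann_eq_zero [T2Space M] {cov : Connection m M} (hflat : IsFlat cov) {p : M}
    {y : EuclideanSpace ℝ (Fin m)} (hy : y ∈ (chartAt (EuclideanSpace ℝ (Fin m)) p).target)
    (hΓ : DifferentiableAt ℝ (christoffel cov p) y) (a b c : EuclideanSpace ℝ (Fin m)) :
    riemann (christoffel cov p) y a b c = 0 := by
  have hq := (chartAt (EuclideanSpace ℝ (Fin m)) p).map_target hy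
  have hr := (chartAt (EuclideanSpace ℝ (Fin m)) p).right_inv hy
  obtain ⟨X, hX, hXe⟩ := exists_smoothField_eq_frame hq a
  obtain ⟨Y, hY, hYe⟩ := exists_smoothField_eq_frame hq b
  obtain ⟨Z, hZ, hZe⟩ := exists_smoothField_eq_frame hq c
  have h := coordMap_curvature hq (by rwa [hr]) hXe hYe hZe
  rw [hflat X Y Z hX hY hZ, map_zero, hr] at h
  exact h.symm

/-- The curvature tensor in the preferred chart. -/
theorem curvatureTensor_eq {cov : Connection m M} {p : M}
    (hΓ : DifferentiableAt ℝ (christoffel cov p) (chartAt (EuclideanSpace ℝ (Fin m)) p p))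
    (u v w : TangentSpace (𝓡 m) p) :
    curvatureTensor cov p u v w =
      riemann (christoffel cov p) (chartAt (EuclideanSpace ℝ (Fin m)) p p) u v w := by
  have hp := mem_chart_source (EuclideanSpace ℝ (Fin m)) p
  have he : ∀ u : TangentSpace (𝓡 m) p,
      (FiberBundle.extend (EuclideanSpace ℝ (Fin m)) u : Π q : M, TangentSpace (𝓡 m) q)
        =ᶠ[𝓝 p] frame p (coordMap p p u) := by
    intro u
    filter_upwards [(chartAt (EuclideanSpace ℝ (Fin m)) p).open_source.mem_nhds hp] with q hq
    exact extend_eq_frame hq u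
  have h := coordMap_curvature hp hΓ (he u) (he v) (he w)
  rw [coordMap_self, coordMap_self, coordMap_self, coordMap_self] at h
  exact h

theorem ricci_eq {cov : Connection m M} {p : M}
    (hΓ : DifferentiableAt ℝ (christoffel cov p) (chartAt (EuclideanSpace ℝ (Fin m)) p p))
    (v w : TangentSpace (𝓡 m) p) :
    ricci cov p v w = ∑ i, riemann (christoffel cov p)
      (chartAt (EuclideanSpace ℝ (Fin m)) p p) (EuclideanSpace.single i 1) v w i := by
  refine Finset.sum_congr rfl fun i _ ↦ ?_
  rw [curvatureTensor_eq hΓ]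
  have h : ∀ v w : EuclideanSpace ℝ (Fin m), (EuclideanSpace.basisFun (Fin m) ℝ).toBasis.repr
      (riemann (christoffel cov p) (chartAt (EuclideanSpace ℝ (Fin m)) p p)
        ((EuclideanSpace.basisFun (Fin m) ℝ).toBasis i) v w) i =
      riemann (christoffel cov p) (chartAt (EuclideanSpace ℝ (Fin m)) p p)
        (EuclideanSpace.single i 1) v w i := fun v w ↦ by simp
  exact h v w

/-- The change `η ↦ (a, b ↦ η a • b + η b • a)` of the Christoffel symbols under a projective
change of the connection. -/
def projectiveChange (E : Type*) [NormedAddCommGroup E] [NormedSpace ℝ E] :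
    (E →L[ℝ] ℝ) →L[ℝ] E →L[ℝ] E →L[ℝ] E :=
  ((ContinuousLinearMap.smulRightL ℝ E (E →L[ℝ] E)).flip (ContinuousLinearMap.id ℝ E)) +
    ((ContinuousLinearMap.flipₗᵢ ℝ E E E).toContinuousLinearEquiv : _ →L[ℝ] _).comp
      ((ContinuousLinearMap.smulRightL ℝ E (E →L[ℝ] E)).flip (ContinuousLinearMap.id ℝ E))

theorem projectiveChange_apply {E : Type*} [NormedAddCommGroup E] [NormedSpace ℝ E]
    (η : E →L[ℝ] ℝ) (a b : E) : projectiveChange E η a b = η a • b + η b • a := by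
  simp [projectiveChange]

theorem christoffel_perturb {cov : Connection m M} {g : M → ℝ}
    (hg : ContMDiff (𝓡 m) 𝓘(ℝ, ℝ) ∞ g) {p : M} {y : EuclideanSpace ℝ (Fin m)}
    (hy : y ∈ (chartAt (EuclideanSpace ℝ (Fin m)) p).target) :
    christoffel (perturb g cov) p y = christoffel cov p y +
      projectiveChange _ (fderiv ℝ (g ∘ (chartAt (EuclideanSpace ℝ (Fin m)) p).symm) y) := by
  have hq := (chartAt (EuclideanSpace ℝ (Fin m)) p).map_target hy
  have hr := (chartAt (EuclideanSpace ℝ (Fin m)) p).right_inv hy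
  ext1 a
  ext1 b
  have h1 := coordMap_cov_frame (perturb g cov) hq b (frameMap p _ a)
  have h2 := coordMap_cov_frame cov hq b (frameMap p _ a)
  have h3 : ∀ a, mvfderiv (𝓡 m) g _ (frameMap p _ a) =
      fderiv ℝ (g ∘ (chartAt (EuclideanSpace ℝ (Fin m)) p).symm) y a := fun a ↦ by
    rw [mvfderiv_eq_fderiv_coordMap hq ((hg _).mdifferentiableAt (by simp)), coordMap_frameMap hq,
      hr]
  rw [coordMap_frameMap hq, hr] at h1 h2
  rw [← h1, add_apply, add_apply, ← h2, projectiveChange_apply, ← h3, ← h3]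
  have h4 : (perturb g cov) (frame p b) ((chartAt (EuclideanSpace ℝ (Fin m)) p).symm y)
      (frameMap p _ a) = cov (frame p b) _ (frameMap p _ a) +
      mvfderiv (𝓡 m) g _ (frameMap p _ a) • frameMap p _ b +
      mvfderiv (𝓡 m) g _ (frameMap p _ b) • frameMap p _ a := rfl
  rw [h4, map_add, map_add, map_smul, map_smul, coordMap_frameMap hq, coordMap_frameMap hq, add_assoc]

/-- The curvature under a projective change of the connection. -/
theorem riemann_projectiveChange {E : Type*} [NormedAddCommGroup E] [NormedSpace ℝ E]
    {Γ Γ' : E → E →L[ℝ] E →L[ℝ] E} {h : E → ℝ} {y : E} (hΓ : DifferentiableAt ℝ Γ y)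
    (hsymm : ∀ a b, Γ y a b = Γ y b a) (hh : ContDiffAt ℝ 2 h y)
    (hΓ' : Γ' =ᶠ[𝓝 y] fun z ↦ Γ z + projectiveChange E (fderiv ℝ h z)) (a b c : E) :
    riemann Γ' y a b c = riemann Γ y a b c +
      (fderiv ℝ (fderiv ℝ h) y a c - fderiv ℝ h y (Γ y a c) -
        fderiv ℝ h y a * fderiv ℝ h y c) • b -
      (fderiv ℝ (fderiv ℝ h) y b c - fderiv ℝ h y (Γ y b c) -
        fderiv ℝ h y b * fderiv ℝ h y c) • a := by
  have hd : DifferentiableAt ℝ (fderiv ℝ h) y :=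
    (hh.fderiv_right (m := 1) (by norm_num)).differentiableAt (by simp)
  have h1 : fderiv ℝ Γ' y = fderiv ℝ Γ y + (projectiveChange E).comp (fderiv ℝ (fderiv ℝ h) y) := by
    rw [hΓ'.fderiv_eq]
    exact (hΓ.hasFDerivAt.add
      ((projectiveChange E).hasFDerivAt.comp y hd.hasFDerivAt)).fderiv
  -- Symmetry of the second derivative cancels the multiples of c; symmetry of Γ cancels those of Γ
  -- y a b.
  have hs : fderiv ℝ (fderiv ℝ h) y a b = fderiv ℝ (fderiv ℝ h) y b a :=
    hh.isSymmSndFDerivAt (by simp) a b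
  simp only [riemann, h1, hΓ'.eq_of_nhds, add_apply, ContinuousLinearMap.comp_apply,
    projectiveChange_apply, map_add, map_smul, hs, hsymm b a]
  module

end Curvature

/-! ### Functions with vanishing Hessian -/

section AffineFunctions

variable {m : ℕ} {M : Type*} [TopologicalSpace M]
  [ChartedSpace (EuclideanSpace ℝ (Fin m)) M] [IsManifold (𝓡 m) ∞ M]

/-- The function `f` is smooth at `q` with vanishing Hessian. -/
structure IsAffineFunAt (cov : Connection m M) (f : M → ℝ) (q : M) : Prop where
  smooth : ContMDiffAt (𝓡 m) 𝓘(ℝ, ℝ) ∞ f q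
  hess : ∀ Y : Π q : M, TangentSpace (𝓡 m) q,
    MDifferentiableAt (𝓡 m) (𝓡 m).tangent (fun y ↦ (⟨y, Y y⟩ : TangentBundle (𝓡 m) M)) q →
    ∀ v, mvfderiv (𝓡 m) (fun q' ↦ mvfderiv (𝓡 m) f q' (Y q')) q v = mvfderiv (𝓡 m) f q (cov Y q v)

theorem eventually_mdifferentiableAt {f : M → ℝ} {q : M}
    (hf : ContMDiffAt (𝓡 m) 𝓘(ℝ, ℝ) ∞ f q) :
    ∀ᶠ q' in 𝓝 q, MDifferentiableAt (𝓡 m) 𝓘(ℝ, ℝ) f q' := by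
  have h : ContMDiffAt (𝓡 m) 𝓘(ℝ, ℝ) 1 f q := hf.of_le (by norm_cast)
  filter_upwards [(contMDiffAt_iff_contMDiffAt_nhds (by simp)).1 h] with q' h'
  exact h'.mdifferentiableAt (by simp)

/-- The derivative of a function along a vector field, in coordinates. -/
theorem mvfderiv_apply_eventuallyEq {f : M → ℝ} {p q : M}
    (hq : q ∈ (chartAt (EuclideanSpace ℝ (Fin m)) p).source)
    (hf : ContMDiffAt (𝓡 m) 𝓘(ℝ, ℝ) ∞ f q) (Y : Π q : M, TangentSpace (𝓡 m) q) :
    (fun q' ↦ mvfderiv (𝓡 m) f q' (Y q')) =ᶠ[𝓝 q] fun q' ↦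
      fderiv ℝ (f ∘ (chartAt (EuclideanSpace ℝ (Fin m)) p).symm)
        (chartAt (EuclideanSpace ℝ (Fin m)) p q') (coordRep p Y q') := by
  filter_upwards [eventually_mdifferentiableAt hf,
    (chartAt (EuclideanSpace ℝ (Fin m)) p).open_source.mem_nhds hq] with q' h1 h2
  rw [mvfderiv_eq_fderiv_coordMap h2 h1, coordRep]

theorem mdifferentiableAt_mvfderiv_apply {f : M → ℝ} {q : M}
    (hf : ContMDiffAt (𝓡 m) 𝓘(ℝ, ℝ) ∞ f q) {Y : Π q : M, TangentSpace (𝓡 m) q}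
    (hY : MDifferentiableAt (𝓡 m) (𝓡 m).tangent (fun y ↦ (⟨y, Y y⟩ : TangentBundle (𝓡 m) M)) q) :
    MDifferentiableAt (𝓡 m) 𝓘(ℝ, ℝ) (fun q' ↦ mvfderiv (𝓡 m) f q' (Y q')) q := by
  have hq := mem_chart_source (EuclideanSpace ℝ (Fin m)) q
  have hx := IsManifold.chart_mem_maximalAtlas (I := 𝓡 m) (n := ∞) q
  refine MDifferentiableAt.congr_of_eventuallyEq ?_ (mvfderiv_apply_eventuallyEq hq hf Y)
  rw [mdifferentiableAt_iff_comp_symm hx hq]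
  have h1 := ((contMDiffAt_iff_comp_symm hx hq f).1 hf).fderiv_right (m := 1) (by norm_cast)
  have h2 := (mdifferentiableAt_iff_comp_symm hx hq _).1 ((mdifferentiableAt_field_iff hq Y).1 hY)
  refine ((h1.differentiableAt (by simp)).clm_apply h2).congr_of_eventuallyEq ?_
  filter_upwards [(chartAt (EuclideanSpace ℝ (Fin m)) q).open_target.mem_nhds
    ((chartAt (EuclideanSpace ℝ (Fin m)) q).map_source hq)] with y hy
  simp [(chartAt (EuclideanSpace ℝ (Fin m)) q).right_inv hy]

/-- The Hessian in coordinates. -/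
theorem hessian_eq (cov : Connection m M) {f : M → ℝ} {p q : M}
    (hq : q ∈ (chartAt (EuclideanSpace ℝ (Fin m)) p).source)
    (hf : ContMDiffAt (𝓡 m) 𝓘(ℝ, ℝ) ∞ f q) {Y : Π q : M, TangentSpace (𝓡 m) q}
    (hY : MDifferentiableAt (𝓡 m) (𝓡 m).tangent (fun y ↦ (⟨y, Y y⟩ : TangentBundle (𝓡 m) M)) q)
    (v : TangentSpace (𝓡 m) q) :
    mvfderiv (𝓡 m) (fun q' ↦ mvfderiv (𝓡 m) f q' (Y q')) q v - mvfderiv (𝓡 m) f q (cov Y q v) =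
      fderiv ℝ (fderiv ℝ (f ∘ (chartAt (EuclideanSpace ℝ (Fin m)) p).symm))
        (chartAt (EuclideanSpace ℝ (Fin m)) p q) (coordMap p q v) (coordRep p Y q) -
      fderiv ℝ (f ∘ (chartAt (EuclideanSpace ℝ (Fin m)) p).symm)
        (chartAt (EuclideanSpace ℝ (Fin m)) p q)
        (christoffel cov p (chartAt (EuclideanSpace ℝ (Fin m)) p q) (coordMap p q v)
          (coordRep p Y q)) := by
  have hx := IsManifold.chart_mem_maximalAtlas (I := 𝓡 m) (n := ∞) p
  have h1 := ((contMDiffAt_iff_comp_symm hx hq f).1 hf).fderiv_right (m := 1) (by norm_cast)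
  have hY' := (mdifferentiableAt_field_iff hq Y).1 hY
  have h2 := (mdifferentiableAt_iff_comp_symm hx hq _).1 hY'
  have h3 := mvfderiv_apply_eventuallyEq hq hf Y
  have h4 := (h1.differentiableAt (by simp)).hasFDerivAt.clm_apply h2.hasFDerivAt
  have h5 : (fun q' ↦ fderiv ℝ (f ∘ (chartAt (EuclideanSpace ℝ (Fin m)) p).symm)
        (chartAt (EuclideanSpace ℝ (Fin m)) p q') (coordRep p Y q')) ∘
        (chartAt (EuclideanSpace ℝ (Fin m)) p).symm
      =ᶠ[𝓝 (chartAt (EuclideanSpace ℝ (Fin m)) p q)] fun y ↦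
        fderiv ℝ (f ∘ (chartAt (EuclideanSpace ℝ (Fin m)) p).symm) y
          ((coordRep p Y ∘ (chartAt (EuclideanSpace ℝ (Fin m)) p).symm) y) := by
    filter_upwards [(chartAt (EuclideanSpace ℝ (Fin m)) p).open_target.mem_nhds
      ((chartAt (EuclideanSpace ℝ (Fin m)) p).map_source hq)] with y hy
    simp [(chartAt (EuclideanSpace ℝ (Fin m)) p).right_inv hy]
  have h6 := (mdifferentiableAt_mvfderiv_apply hf hY).congr_of_eventuallyEq h3.symm
  rw [mvfderiv_congr h3, mvfderiv_eq_fderiv_coordMap hq h6, h5.fderiv_eq, h4.fderiv,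
    mvfderiv_eq_fderiv_coordMap hq (hf.mdifferentiableAt (by simp)), coordMap_cov cov hq hY,
    mvfderiv_eq_fderiv_coordMap hq hY']
  simp [(chartAt (EuclideanSpace ℝ (Fin m)) p).left_inv hq]

/-- By `hessian_eq` the Hessian depends only on the values at q of its two arguments, so fields with
constant components suffice. -/
theorem isAffineFunAt_iff (cov : Connection m M) {f : M → ℝ} {p q : M}
    (hq : q ∈ (chartAt (EuclideanSpace ℝ (Fin m)) p).source)
    (hf : ContMDiffAt (𝓡 m) 𝓘(ℝ, ℝ) ∞ f q) :
    IsAffineFunAt cov f q ↔ ∀ a b,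
      fderiv ℝ (fderiv ℝ (f ∘ (chartAt (EuclideanSpace ℝ (Fin m)) p).symm))
        (chartAt (EuclideanSpace ℝ (Fin m)) p q) a b =
      fderiv ℝ (f ∘ (chartAt (EuclideanSpace ℝ (Fin m)) p).symm)
        (chartAt (EuclideanSpace ℝ (Fin m)) p q)
        (christoffel cov p (chartAt (EuclideanSpace ℝ (Fin m)) p q) a b) := by
  constructor
  · intro h a b
    have h1 := hessian_eq cov hq hf (mdifferentiableAt_frame hq b) (frameMap p q a)
    rw [h.hess _ (mdifferentiableAt_frame hq b), sub_self, coordRep, frame, coordMap_frameMap hq,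
      coordMap_frameMap hq] at h1
    exact (sub_eq_zero.1 h1.symm)
  · intro h
    refine ⟨hf, fun Y hY v ↦ ?_⟩
    have h1 := hessian_eq cov hq hf hY v
    rw [h, sub_self] at h1
    exact sub_eq_zero.1 h1

/-- Passes from smooth test fields to fields merely differentiable at q, the regularity available
for pulled-back fields in `isPullback_trivialConnection`. -/
theorem isAffineFunAt_of_hessian [T2Space M] {cov : Connection m M} {f : M → ℝ} {q : M}
    (hf : ContMDiffAt (𝓡 m) 𝓘(ℝ, ℝ) ∞ f q)
    (h : ∀ X Y : Π p : M, TangentSpace (𝓡 m) p, IsSmoothField X → IsSmoothField Y →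
      hessian cov f X Y q = 0) : IsAffineFunAt cov f q := by
  have hq := mem_chart_source (EuclideanSpace ℝ (Fin m)) q
  refine (isAffineFunAt_iff cov hq hf).2 fun a b ↦ ?_
  obtain ⟨X, hX, hXe⟩ := exists_smoothField_eq_frame hq a
  obtain ⟨Y, hY, hYe⟩ := exists_smoothField_eq_frame hq b
  have h1 := hessian_eq cov hq hf ((hY q).mdifferentiableAt (by simp)) (X q)
  have h2 := h X Y hX hY
  rw [hessian] at h2
  rw [h2, coordRep, hXe.eq_of_nhds, hYe.eq_of_nhds, frame, frame, coordMap_frameMap hq,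
    coordMap_frameMap hq] at h1
  exact sub_eq_zero.1 h1.symm

theorem IsAffineFunAt.congr {cov : Connection m M} {f g : M → ℝ} {q : M}
    (hf : IsAffineFunAt cov f q) (h : g =ᶠ[𝓝 q] f) : IsAffineFunAt cov g q := by
  refine ⟨hf.smooth.congr_of_eventuallyEq h, fun Y hY v ↦ ?_⟩
  rw [mvfderiv_congr h, ← hf.hess Y hY v, mvfderiv_congr]
  filter_upwards [h.eventuallyEq_nhds] with q' hq'
  rw [mvfderiv_congr hq']

theorem isAffineFunAt_const (cov : Connection m M) (c : ℝ) (q : M) :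
    IsAffineFunAt cov (fun _ ↦ c) q := by
  refine ⟨contMDiffAt_const, fun Y hY v ↦ ?_⟩
  simp only [mvfderiv_const]
  simp [mvfderiv_const]

theorem IsAffineFunAt.add {cov : Connection m M} {f g : M → ℝ} {q : M}
    (hf : IsAffineFunAt cov f q) (hg : IsAffineFunAt cov g q) : IsAffineFunAt cov (f + g) q := by
  refine ⟨hf.smooth.add hg.smooth, fun Y hY v ↦ ?_⟩
  have h : (fun q' ↦ mvfderiv (𝓡 m) (f + g) q' (Y q')) =ᶠ[𝓝 q]
      (fun q' ↦ mvfderiv (𝓡 m) f q' (Y q')) + fun q' ↦ mvfderiv (𝓡 m) g q' (Y q') := by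
    filter_upwards [eventually_mdifferentiableAt hf.smooth,
      eventually_mdifferentiableAt hg.smooth] with q' h1 h2
    rw [mvfderiv_add h1 h2]
    rfl
  rw [mvfderiv_congr h, mvfderiv_add (mdifferentiableAt_mvfderiv_apply hf.smooth hY)
    (mdifferentiableAt_mvfderiv_apply hg.smooth hY), mvfderiv_add
    (hf.smooth.mdifferentiableAt (by simp)) (hg.smooth.mdifferentiableAt (by simp)),
    add_apply, add_apply, hf.hess Y hY, hg.hess Y hY]

theorem mvfderiv_const_smul {f : M → ℝ} {q : M}
    (hf : MDifferentiableAt (𝓡 m) 𝓘(ℝ, ℝ) f q) (c : ℝ) :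
    mvfderiv (𝓡 m) (c • f) q = c • mvfderiv (𝓡 m) f q := by
  have := mvfderiv_smul (I := 𝓡 m) (a := fun _ : M ↦ c) mdifferentiableAt_const hf
  rw [mvfderiv_const] at this
  refine Eq.trans this ?_
  ext v
  simp

theorem IsAffineFunAt.const_smul {cov : Connection m M} {f : M → ℝ} {q : M}
    (hf : IsAffineFunAt cov f q) (c : ℝ) : IsAffineFunAt cov (c • f) q := by
  refine ⟨(contMDiffAt_const (I := 𝓡 m) (I' := 𝓘(ℝ, ℝ)) (c := c)).smul hf.smooth, fun Y hY v ↦ ?_⟩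
  have h : (fun q' ↦ mvfderiv (𝓡 m) (c • f) q' (Y q')) =ᶠ[𝓝 q]
      c • (fun q' ↦ mvfderiv (𝓡 m) f q' (Y q')) := by
    filter_upwards [eventually_mdifferentiableAt hf.smooth] with q' h1
    rw [mvfderiv_const_smul h1]
    rfl
  rw [mvfderiv_congr h, mvfderiv_const_smul (mdifferentiableAt_mvfderiv_apply hf.smooth hY),
    mvfderiv_const_smul (hf.smooth.mdifferentiableAt (by simp)), smul_apply, smul_apply,
    hf.hess Y hY]

theorem IsAffineFunAt.sub {cov : Connection m M} {f g : M → ℝ} {q : M}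
    (hf : IsAffineFunAt cov f q) (hg : IsAffineFunAt cov g q) : IsAffineFunAt cov (f - g) q := by
  have := hf.add (hg.const_smul (-1))
  rwa [neg_one_smul, ← sub_eq_add_neg] at this

theorem IsAffineFunAt.sum {cov : Connection m M} {ι : Type*} {s : Finset ι} {f : ι → M → ℝ} {q : M}
    (hf : ∀ i ∈ s, IsAffineFunAt cov (f i) q) : IsAffineFunAt cov (∑ i ∈ s, f i) q := by
  classical
  induction s using Finset.induction_on with
  | empty => exact isAffineFunAt_const cov 0 q
  | insert i s hi ih =>
    rw [Finset.sum_insert hi]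
    exact (hf i (by simp)).add (ih fun j hj ↦ hf j (by simp [hj]))

/-- The first jet of a function. -/
def jet (f : M → ℝ) (q : M) : ℝ × (EuclideanSpace ℝ (Fin m) →L[ℝ] ℝ) :=
  (f q, mvfderiv (𝓡 m) f q)

theorem jet_sub {f g : M → ℝ} {q : M} (hf : MDifferentiableAt (𝓡 m) 𝓘(ℝ, ℝ) f q)
    (hg : MDifferentiableAt (𝓡 m) 𝓘(ℝ, ℝ) g q) : jet (m := m) (f - g) q = jet f q - jet g q := by
  rw [jet, mvfderiv_sub hf hg]
  rfl

theorem jet_congr {f g : M → ℝ} {q : M} (h : f =ᶠ[𝓝 q] g) : jet (m := m) f q = jet g q := by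
  rw [jet, mvfderiv_congr h, h.eq_of_nhds]
  rfl

end AffineFunctions

/-! ### The connection on first jets -/

section JetForm

variable {E : Type*} [NormedAddCommGroup E] [NormedSpace ℝ E]

/-- The action `B ↦ ((c, α) ↦ (0, α ∘ B))` of endomorphisms on jets. -/
def jetAction (E : Type*) [NormedAddCommGroup E] [NormedSpace ℝ E] :
    (E →L[ℝ] E) →L[ℝ] (ℝ × (E →L[ℝ] ℝ)) →L[ℝ] (ℝ × (E →L[ℝ] ℝ)) :=
  ContinuousLinearMap.compL ℝ (ℝ × (E →L[ℝ] ℝ)) (E →L[ℝ] ℝ) (ℝ × (E →L[ℝ] ℝ))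
      (ContinuousLinearMap.inr ℝ ℝ (E →L[ℝ] ℝ)) ∘L
    (ContinuousLinearMap.compL ℝ (ℝ × (E →L[ℝ] ℝ)) (E →L[ℝ] ℝ) (E →L[ℝ] ℝ)).flip
      (ContinuousLinearMap.snd ℝ ℝ (E →L[ℝ] ℝ)) ∘L
    (ContinuousLinearMap.compL ℝ E E ℝ).flip

theorem jetAction_apply (B : E →L[ℝ] E) (v : ℝ × (E →L[ℝ] ℝ)) :
    jetAction E B v = (0, v.2 ∘L B) := by
  simp [jetAction]

/-- The map `u ↦ ((c, α) ↦ (α u, 0))`. -/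
def jetEval (E : Type*) [NormedAddCommGroup E] [NormedSpace ℝ E] :
    E →L[ℝ] (ℝ × (E →L[ℝ] ℝ)) →L[ℝ] (ℝ × (E →L[ℝ] ℝ)) :=
  ContinuousLinearMap.compL ℝ (ℝ × (E →L[ℝ] ℝ)) ℝ (ℝ × (E →L[ℝ] ℝ))
      (ContinuousLinearMap.inl ℝ ℝ (E →L[ℝ] ℝ)) ∘L
    (ContinuousLinearMap.compL ℝ (ℝ × (E →L[ℝ] ℝ)) (E →L[ℝ] ℝ) ℝ).flip
      (ContinuousLinearMap.snd ℝ ℝ (E →L[ℝ] ℝ)) ∘L ContinuousLinearMap.apply ℝ ℝ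

theorem jetEval_apply (u : E) (v : ℝ × (E →L[ℝ] ℝ)) : jetEval E u v = (v.2 u, 0) := by
  simp [jetEval]

/-- The connection form on first jets `(c, α)` whose parallel sections are the jets of the affine
functions of the connection with Christoffel symbols `Γ`. -/
def jetForm (Γ : E → E →L[ℝ] E →L[ℝ] E) (y : E) :
    E →L[ℝ] (ℝ × (E →L[ℝ] ℝ)) →L[ℝ] (ℝ × (E →L[ℝ] ℝ)) :=
  jetEval E + jetAction E ∘L Γ y

theorem jetForm_apply (Γ : E → E →L[ℝ] E →L[ℝ] E) (y u : E) (v : ℝ × (E →L[ℝ] ℝ)) :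
    jetForm Γ y u v = (v.2 u, v.2 ∘L Γ y u) := by
  simp [jetForm, jetEval_apply, jetAction_apply]

theorem contDiffOn_jetForm {Γ : E → E →L[ℝ] E →L[ℝ] E} {s : Set E} (hΓ : ContDiffOn ℝ ∞ Γ s) :
    ContDiffOn ℝ ∞ (jetForm Γ) s :=
  contDiffOn_const.add (contDiffOn_const.clm_comp hΓ)

theorem fderiv_jetForm {Γ : E → E →L[ℝ] E →L[ℝ] E} {y : E} (hΓ : DifferentiableAt ℝ Γ y)
    (u v : E) : fderiv ℝ (jetForm Γ) y u v = jetAction E (fderiv ℝ Γ y u v) := by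
  have h : HasFDerivAt (jetForm Γ)
      (ContinuousLinearMap.compL ℝ E _ _ (jetAction E) ∘L fderiv ℝ Γ y) y :=
    (((ContinuousLinearMap.compL ℝ E _ _ (jetAction E)).hasFDerivAt.comp y
      hΓ.hasFDerivAt).const_add (jetEval E))
  rw [h.fderiv]
  simp

/-- On the function component the condition is the symmetry of Γ; on the covector component it is
the covector applied to the vanishing curvature. -/
theorem jetForm_integrable {Γ : E → E →L[ℝ] E →L[ℝ] E} {y : E} (hΓ : DifferentiableAt ℝ Γ y)
    (hsymm : ∀ a b, Γ y a b = Γ y b a) (hR : ∀ a b c, riemann Γ y a b c = 0) (u v : E) :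
    fderiv ℝ (jetForm Γ) y u v + jetForm Γ y v ∘L jetForm Γ y u =
      fderiv ℝ (jetForm Γ) y v u + jetForm Γ y u ∘L jetForm Γ y v := by
  refine ContinuousLinearMap.ext fun w ↦ ?_
  rw [fderiv_jetForm hΓ, fderiv_jetForm hΓ]
  simp only [add_apply, ContinuousLinearMap.comp_apply, jetAction_apply, jetForm_apply,
    Prod.mk_add_mk]
  refine Prod.ext ?_ (ContinuousLinearMap.ext fun c ↦ ?_)
  · simp [hsymm u v]
  · have h := congrArg w.2 (hR u v c)
    simp only [riemann, map_add, map_sub, map_zero] at h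
    simp only [add_apply, ContinuousLinearMap.comp_apply]
    linarith

end JetForm

/-! ### Local existence and uniqueness of affine functions -/

section LocalTheory

variable {m : ℕ} {M : Type*} [TopologicalSpace M]
  [ChartedSpace (EuclideanSpace ℝ (Fin m)) M] [IsManifold (𝓡 m) ∞ M]

/-- In each preferred chart, the Christoffel symbols are smooth and symmetric, and their curvature
vanishes. -/
structure HasFlatSymbols (cov : Connection m M) : Prop where
  smooth : ∀ p, ContDiffOn ℝ ∞ (christoffel cov p) (chartAt (EuclideanSpace ℝ (Fin m)) p).target
  symm : ∀ p, ∀ y ∈ (chartAt (EuclideanSpace ℝ (Fin m)) p).target, ∀ a b,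
    christoffel cov p y a b = christoffel cov p y b a
  riemann_eq : ∀ p, ∀ y ∈ (chartAt (EuclideanSpace ℝ (Fin m)) p).target, ∀ a b c,
    riemann (christoffel cov p) y a b c = 0

theorem HasFlatSymbols.of_smooth_of_symm [T2Space M] {cov : Connection m M}
    (h1 : ∀ p, ContDiffOn ℝ ∞ (christoffel cov p) (chartAt (EuclideanSpace ℝ (Fin m)) p).target)
    (h2 : ∀ p, ∀ y ∈ (chartAt (EuclideanSpace ℝ (Fin m)) p).target, ∀ a b,
      christoffel cov p y a b = christoffel cov p y b a) (hflat : IsFlat cov) :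
    HasFlatSymbols cov :=
  ⟨h1, h2, fun p y hy ↦ riemann_eq_zero hflat hy
    (((h1 p).contDiffAt ((chartAt _ p).open_target.mem_nhds hy)).differentiableAt (by simp))⟩

theorem IsAffine.hasFlatSymbols [T2Space M] {cov : Connection m M} (hcov : IsAffine cov)
    (hflat : IsFlat cov) : HasFlatSymbols cov :=
  .of_smooth_of_symm (contDiffOn_christoffel hcov.smooth)
    (fun _ _ hy ↦ christoffel_symm hcov.torsion_free hy) hflat

/-- The perturbation adds to the symbols a term that is smooth and symmetric, so both properties
pass over from the original connection. -/
theorem IsAffine.hasFlatSymbols_perturb [T2Space M] {cov : Connection m M} (hcov : IsAffine cov)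
    {g : M → ℝ} (hg : ContMDiff (𝓡 m) 𝓘(ℝ, ℝ) ∞ g) (hflat : IsFlat (perturb g cov)) :
    HasFlatSymbols (perturb g cov) := by
  refine .of_smooth_of_symm (fun p ↦ ?_) (fun p y hy a b ↦ ?_) hflat
  · have h1 : ContDiffOn ℝ ∞ (g ∘ (chartAt (EuclideanSpace ℝ (Fin m)) p).symm)
        (chartAt (EuclideanSpace ℝ (Fin m)) p).target := fun y hy ↦ by
      have h2 := (contMDiffAt_iff_comp_symm (IsManifold.chart_mem_maximalAtlas p)
        ((chartAt (EuclideanSpace ℝ (Fin m)) p).map_target hy) g).1 (hg _)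
      rw [(chartAt (EuclideanSpace ℝ (Fin m)) p).right_inv hy] at h2
      exact h2.contDiffWithinAt
    have h3 := h1.fderiv_of_isOpen (m := ∞) (chartAt (EuclideanSpace ℝ (Fin m)) p).open_target
      (by norm_cast)
    refine ((contDiffOn_christoffel hcov.smooth p).add
      ((projectiveChange _).contDiff.comp_contDiffOn h3)).congr fun y hy ↦ ?_
    exact christoffel_perturb hg hy
  · rw [christoffel_perturb hg hy, add_apply, add_apply, add_apply, add_apply,
      projectiveChange_apply, projectiveChange_apply, christoffel_symm hcov.torsion_free hy a b,
      add_comm (fderiv ℝ _ _ a • b)]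

/-- The jet of a function in the preferred chart at `p`. -/
def coordJet (f : M → ℝ) (p : M) (y : EuclideanSpace ℝ (Fin m)) :
    ℝ × (EuclideanSpace ℝ (Fin m) →L[ℝ] ℝ) :=
  ((f ∘ (chartAt (EuclideanSpace ℝ (Fin m)) p).symm) y,
    fderiv ℝ (f ∘ (chartAt (EuclideanSpace ℝ (Fin m)) p).symm) y)

theorem jet_eq_coordJet {f : M → ℝ} {p q : M}
    (hq : q ∈ (chartAt (EuclideanSpace ℝ (Fin m)) p).source)
    (hf : MDifferentiableAt (𝓡 m) 𝓘(ℝ, ℝ) f q) :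
    jet (m := m) f q = ((coordJet f p (chartAt (EuclideanSpace ℝ (Fin m)) p q)).1, (coordJet f p (chartAt (EuclideanSpace ℝ (Fin m)) p q)).2 ∘L
      coordMap p q) := by
  refine Prod.ext ?_ (ContinuousLinearMap.ext fun u ↦ mvfderiv_eq_fderiv_coordMap hq hf u)
  simp [jet, coordJet, (chartAt (EuclideanSpace ℝ (Fin m)) p).left_inv hq]

/-- The jets of affine functions are parallel. -/
theorem IsAffineFunAt.hasFDerivAt_coordJet {cov : Connection m M} {f : M → ℝ} {p q : M}
    (hq : q ∈ (chartAt (EuclideanSpace ℝ (Fin m)) p).source) (hf : IsAffineFunAt cov f q) :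
    HasFDerivAt (coordJet f p) ((jetForm (christoffel cov p)
      (chartAt (EuclideanSpace ℝ (Fin m)) p q)).flip (coordJet f p (chartAt (EuclideanSpace ℝ (Fin m)) p q)))
      (chartAt (EuclideanSpace ℝ (Fin m)) p q) := by
  have h1 := (contMDiffAt_iff_comp_symm (IsManifold.chart_mem_maximalAtlas p) hq f).1 hf.smooth
  have h2 := (h1.differentiableAt (by simp)).hasFDerivAt.prodMk
    ((h1.fderiv_right (m := 1) (by norm_cast)).differentiableAt (by simp)).hasFDerivAt
  refine h2.congr_fderiv (ContinuousLinearMap.ext fun u ↦ ?_)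
  simp only [ContinuousLinearMap.prod_apply, ContinuousLinearMap.flip_apply, jetForm_apply]
  refine Prod.ext rfl (ContinuousLinearMap.ext fun v ↦ ?_)
  exact (isAffineFunAt_iff cov hq hf.smooth).1 hf u v

/-- Affine functions exist near every point with prescribed jets, which determine them. -/
theorem HasFlatSymbols.exists_local {cov : Connection m M} (hcov : HasFlatSymbols cov) (p : M)
    {W : Set M} (hW : W ∈ 𝓝 p) :
    ∃ U ⊆ W, IsOpen U ∧ p ∈ U ∧
      (∀ q₁ ∈ U, ∀ v, ∃ f : M → ℝ, (∀ q ∈ U, IsAffineFunAt cov f q) ∧ jet (m := m) f q₁ = v) ∧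
      ∀ f : M → ℝ, (∀ q ∈ U, IsAffineFunAt cov f q) → ∀ q₁ ∈ U, jet (m := m) f q₁ = 0 →
        ∀ q ∈ U, jet (m := m) f q = 0 := by
  set x := chartAt (EuclideanSpace ℝ (Fin m)) p with hxdef
  have hxm := IsManifold.chart_mem_maximalAtlas (I := 𝓡 m) (n := ∞) p
  set A := jetForm (christoffel cov p)
  have hA : ContDiffOn ℝ ∞ A x.target := contDiffOn_jetForm (hcov.smooth p)
  have hp : p ∈ x.source := mem_chart_source _ p
  have hxp := x.map_source hp
  -- The bound K near x p is for the uniqueness half, which is a Grönwall argument.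
  obtain ⟨K, hK⟩ : ∃ K, ∀ᶠ z in 𝓝 (x p), ‖A z‖ ≤ K := ⟨‖A (x p)‖ + 1,
    ((hA.contDiffAt (x.open_target.mem_nhds hxp)).continuousAt.norm.eventually_le_const
      (by simp))⟩
  have hWs : ∀ᶠ z in 𝓝 (x p), x.symm z ∈ W := by
    refine (x.continuousAt_symm hxp).eventually ?_
    rw [x.left_inv hp]
    exact hW
  obtain ⟨s, hs, hso, hps⟩ := _root_.mem_nhds_iff.1
    (inter_mem (inter_mem hK hWs) (x.open_target.mem_nhds hxp))
  have hst : s ⊆ x.target := fun z hz ↦ (hs hz).2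
  have hd : ∀ z ∈ s, DifferentiableAt ℝ (christoffel cov p) z := fun z hz ↦
    ((hcov.smooth p).contDiffAt (x.open_target.mem_nhds (hst hz))).differentiableAt (by simp)
  obtain ⟨r, hr, hrs, hsol⟩ := exists_ball_hasFDerivAt_of_integrable hso hps (hA.mono hst)
    fun z hz ↦ jetForm_integrable (hd z hz) (hcov.symm p z (hst hz)) (hcov.riemann_eq p z (hst hz))
  have hmem : ∀ z ∈ ball (x p) r, z ∈ x.target := fun z hz ↦ hst (hrs hz)
  refine ⟨x.source ∩ x ⁻¹' ball (x p) r, fun q hq ↦ ?_, x.isOpen_inter_preimage isOpen_ball,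
    ⟨hp, mem_ball_self hr⟩, fun q₁ hq₁ v ↦ ?_, fun f hf q₁ hq₁ h0 ↦ ?_⟩
  · have := (hs (hrs hq.2)).1.2
    rwa [mem_ofPred_eq, x.left_inv hq.1] at this
  · obtain ⟨F, hF0, hF⟩ := hsol (x q₁) hq₁.2 (v.1, v.2 ∘L frameMap p q₁)
    have hFs : ContDiffOn ℝ ∞ F (ball (x p) r) :=
      contDiffOn_of_hasFDerivAt isOpen_ball (hA.mono hmem) hF
    -- A parallel section is the jet of its first component; the second half of the equation is then
    -- the vanishing of the Hessian.
    have hF1 : ∀ z ∈ ball (x p) r, HasFDerivAt (fun z ↦ (F z).1) (F z).2 z := by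
      intro z hz
      refine (hF z hz).fst.congr_fderiv (ContinuousLinearMap.ext fun u ↦ ?_)
      simp [A, jetForm_apply]
    have hcomp : ∀ z ∈ ball (x p) r, ((fun q ↦ (F (x q)).1) ∘ x.symm) =ᶠ[𝓝 z] fun z ↦ (F z).1 := by
      intro z hz
      filter_upwards [isOpen_ball.mem_nhds hz] with z' hz'
      simp [x.right_inv (hmem z' hz')]
    have hsm : ∀ q ∈ x.source ∩ x ⁻¹' ball (x p) r,
        ContMDiffAt (𝓡 m) 𝓘(ℝ, ℝ) ∞ (fun q ↦ (F (x q)).1) q := by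
      intro q hq
      rw [contMDiffAt_iff_comp_symm hxm hq.1]
      exact ((hFs.contDiffAt (isOpen_ball.mem_nhds hq.2)).fst).congr_of_eventuallyEq
        (hcomp _ hq.2)
    refine ⟨fun q ↦ (F (x q)).1, fun q hq ↦ ?_, ?_⟩
    · rw [isAffineFunAt_iff cov hq.1 (hsm q hq)]
      intro a b
      have h1 : fderiv ℝ ((fun q ↦ (F (x q)).1) ∘ x.symm) =ᶠ[𝓝 (x q)] fun z ↦ (F z).2 := by
        filter_upwards [isOpen_ball.mem_nhds hq.2] with z hz
        rw [(hcomp z hz).fderiv_eq, (hF1 z hz).fderiv]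
      rw [h1.fderiv_eq, h1.eq_of_nhds, (hF _ hq.2).snd.fderiv]
      simp [A, x, jetForm_apply]
    · rw [jet_eq_coordJet hq₁.1 ((hsm q₁ hq₁).mdifferentiableAt (by simp)), coordJet,
        (hcomp _ hq₁.2).fderiv_eq, (hcomp _ hq₁.2).eq_of_nhds, (hF1 _ hq₁.2).fderiv, hF0]
      refine Prod.ext rfl (ContinuousLinearMap.ext fun u ↦ ?_)
      exact congrArg v.2 (frameMap_coordMap hq₁.1 u)
  · have h1 : ∀ z ∈ ball (x p) r, HasFDerivAt (coordJet f p) ((A z).flip (coordJet f p z)) z := by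
      intro z hz
      have h2 := (hf (x.symm z) ⟨x.map_target (hmem z hz), by
        rwa [mem_preimage, x.right_inv (hmem z hz)]⟩).hasFDerivAt_coordJet
          (p := p) (x.map_target (hmem z hz))
      rwa [x.right_inv (hmem z hz)] at h2
    have h3 : ∀ z ∈ ball (x p) r, coordJet f p z = 0 := by
      refine eq_zero_of_hasFDerivAt (convex_ball _ _) (fun z hz ↦ (hs (hrs hz)).1.1) h1 hq₁.2 ?_
      have h4 := h0
      rw [jet_eq_coordJet hq₁.1 ((hf q₁ hq₁).smooth.mdifferentiableAt (by simp))] at h4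
      have h5 := congrArg Prod.fst h4
      have h6 := congrArg Prod.snd h4
      refine Prod.ext h5 (ContinuousLinearMap.ext fun u ↦ ?_)
      have h7 := congr($h6 (frameMap p q₁ u))
      simp only [ContinuousLinearMap.comp_apply] at h7
      rw [coordMap_frameMap hq₁.1] at h7
      exact h7
    intro q hq
    rw [jet_eq_coordJet hq.1 ((hf q hq).smooth.mdifferentiableAt (by simp)), h3 _ hq.2]
    exact Prod.ext rfl (ContinuousLinearMap.zero_comp _)

end LocalTheory

/-! ### Global uniqueness and existence of affine functions -/

section GlobalTheory

variable {m : ℕ} {M : Type*} [TopologicalSpace M]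
  [ChartedSpace (EuclideanSpace ℝ (Fin m)) M] [IsManifold (𝓡 m) ∞ M]

/-- Local uniqueness makes the vanishing set of the jet both open and closed. -/
theorem HasFlatSymbols.jet_eq_zero [PreconnectedSpace M] {cov : Connection m M}
    (hcov : HasFlatSymbols cov) {f : M → ℝ} (hf : ∀ q, IsAffineFunAt cov f q) {q₀ : M}
    (h0 : jet (m := m) f q₀ = 0) (q : M) : jet (m := m) f q = 0 := by
  have h1 : IsClopen {q | jet (m := m) f q = 0} := by
    constructor
    · refine isOpen_compl_iff.1 (isOpen_iff_mem_nhds.2 fun p hp ↦ ?_)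
      obtain ⟨U, -, hU, hpU, -, huniq⟩ := hcov.exists_local p univ_mem
      filter_upwards [hU.mem_nhds hpU] with q hq h
      exact hp (huniq f (fun q _ ↦ hf q) q hq h p hpU)
    · refine isOpen_iff_mem_nhds.2 fun p hp ↦ ?_
      obtain ⟨U, -, hU, hpU, -, huniq⟩ := hcov.exists_local p univ_mem
      filter_upwards [hU.mem_nhds hpU] with q hq
      exact huniq f (fun q _ ↦ hf q) p hpU hp q hq
  have h2 := h1.eq_univ ⟨q₀, h0⟩
  exact h2.ge (mem_univ q)

/-- An affine function that has a critical point is constant. -/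
theorem HasFlatSymbols.eq_const [PreconnectedSpace M] {cov : Connection m M}
    (hcov : HasFlatSymbols cov) {f : M → ℝ} (hf : ∀ q, IsAffineFunAt cov f q) {q₀ : M}
    (h0 : mvfderiv (𝓡 m) f q₀ = 0) (q : M) : f q = f q₀ := by
  have h1 := hcov.jet_eq_zero (f := f - fun _ ↦ f q₀)
    (fun q ↦ (hf q).sub (isAffineFunAt_const cov _ q)) (q₀ := q₀) (by
      rw [jet_sub ((hf q₀).smooth.mdifferentiableAt (by simp)) mdifferentiableAt_const]
      simp only [jet, h0, mvfderiv_const]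
      exact sub_self _) q
  have h2 := congrArg Prod.fst h1
  simpa [jet, sub_eq_zero] using h2

/-- On a simply connected manifold with a flat connection, every jet at a point extends to a
global affine function. -/
theorem HasFlatSymbols.exists_affine [SimplyConnectedSpace M] {cov : Connection m M}
    (hcov : HasFlatSymbols cov) (q₀ : M) (v₀ : ℝ × (EuclideanSpace ℝ (Fin m) →L[ℝ] ℝ)) :
    ∃ f : M → ℝ, (∀ q, IsAffineFunAt cov f q) ∧ jet f q₀ = v₀ := by
  have : LocallyPathConnectedSpace M :=
    ChartedSpace.locallyPathConnectedSpace (EuclideanSpace ℝ (Fin m)) M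
  have hsub : ∀ {f g : M → ℝ} {q : M}, IsAffineFunAt cov f q → IsAffineFunAt cov g q →
      jet (m := m) (f - g) q = jet f q - jet g q := fun hf hg ↦
    jet_sub (hf.smooth.mdifferentiableAt (by simp)) (hg.smooth.mdifferentiableAt (by simp))
  choose U _ hUo hiU hsol huniq using fun p ↦ hcov.exists_local p univ_mem
  have huniq' : ∀ i, ∀ f g : M → ℝ, (∀ q ∈ U i, IsAffineFunAt cov f q) →
      (∀ q ∈ U i, IsAffineFunAt cov g q) → ∀ q₁ ∈ U i, jet (m := m) f q₁ = jet g q₁ →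
      ∀ q ∈ U i, jet (m := m) f q = jet g q := fun i f g hf hg q₁ hq₁ h q hq ↦ by
    rw [← sub_eq_zero, ← hsub (hf q hq) (hg q hq)]
    refine huniq i _ (fun q hq ↦ (hf q hq).sub (hg q hq)) q₁ hq₁ ?_ q hq
    rw [hsub (hf q₁ hq₁) (hg q₁ hq₁), h, sub_self]
  -- A dummy value outside U i makes the choice of local solutions total.
  have hsol' : ∀ i q₁ v, ∃ f : M → ℝ, q₁ ∈ U i →
      (∀ q ∈ U i, IsAffineFunAt cov f q) ∧ jet (m := m) f q₁ = v := by
    intro i q₁ v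
    by_cases h : q₁ ∈ U i
    · obtain ⟨f, hf⟩ := hsol i q₁ h v
      exact ⟨f, fun _ ↦ hf⟩
    · exact ⟨0, fun h' ↦ absurd h' h⟩
  choose sol hs using hsol'
  obtain ⟨s, hs0, hsec⟩ := exists_global_section U hUo hiU
    (fun i q₁ q₂ v ↦ jet (m := m) (sol i q₁ v) q₂)
    (fun i q hq v ↦ (hs i q v hq).2)
    (fun i q₁ h₁ q₂ h₂ q₃ h₃ v ↦ huniq' i _ _ (hs i q₂ _ h₂).1 (hs i q₁ v h₁).1 q₂ h₂
      (hs i q₂ _ h₂).2 q₃ h₃)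
    -- The overlap of U i and U j need not be connected, so the two solutions are compared only on a
    -- uniqueness neighbourhood W of b inside it.
    (fun i j b hb v ↦ by
      obtain ⟨W, hW, hWo, hbW, -, hWu⟩ := hcov.exists_local b
        (((hUo i).inter (hUo j)).mem_nhds hb)
      filter_upwards [hWo.mem_nhds hbW] with q hq
      have hj : ∀ q ∈ W, IsAffineFunAt cov (sol j b v) q := fun q hq ↦
        (hs j b v hb.2).1 q (hW hq).2
      have hi : ∀ q ∈ W, IsAffineFunAt cov (sol i b v) q := fun q hq ↦
        (hs i b v hb.1).1 q (hW hq).1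
      rw [← sub_eq_zero, ← hsub (hj q hq) (hi q hq)]
      refine hWu _ (fun q hq ↦ (hj q hq).sub (hi q hq)) b hbW ?_ q hq
      rw [hsub (hj b hbW) (hi b hbW), (hs j b v hb.2).2, (hs i b v hb.1).2, sub_self])
    q₀ v₀
  have hev : ∀ i, (fun b ↦ (s b).1) =ᶠ[𝓝 i] sol i i (s i) := fun i ↦
    (hsec i).mono fun b hb ↦ congrArg Prod.fst hb
  refine ⟨fun b ↦ (s b).1, fun q ↦ ((hs q q (s q) (hiU q)).1 q (hiU q)).congr (hev q), ?_⟩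
  rw [jet_congr (hev q₀), (hs q₀ q₀ _ (hiU q₀)).2, hs0]

end GlobalTheory

/-! ### Affine coordinates and the pull-back of the trivial connection -/

section AffineCoordinates

variable {m : ℕ} {M : Type*} [TopologicalSpace M]
  [ChartedSpace (EuclideanSpace ℝ (Fin m)) M] [IsManifold (𝓡 m) ∞ M]

theorem mvfderiv_finset_sum {ι : Type*} {s : Finset ι} {f : ι → M → ℝ} {q : M}
    (hf : ∀ i ∈ s, MDifferentiableAt (𝓡 m) 𝓘(ℝ, ℝ) (f i) q) :
    MDifferentiableAt (𝓡 m) 𝓘(ℝ, ℝ) (∑ i ∈ s, f i) q ∧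
      mvfderiv (𝓡 m) (∑ i ∈ s, f i) q = ∑ i ∈ s, mvfderiv (𝓡 m) (f i) q := by
  classical
  induction s using Finset.induction_on with
  | empty => exact ⟨mdifferentiableAt_const, mvfderiv_const (c := (0 : ℝ))⟩
  | insert i s hi ih =>
    obtain ⟨h1, h2⟩ := ih fun j hj ↦ hf j (by simp [hj])
    rw [Finset.sum_insert hi, Finset.sum_insert hi, ← h2]
    exact ⟨(hf i (by simp)).add h1, mvfderiv_add (hf i (by simp)) h1⟩

/-- If no nontrivial combination of affine functions is constant, then their differentials are
linearly independent at each point. -/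
theorem HasFlatSymbols.eq_zero_of_sum_mvfderiv_eq_zero [PreconnectedSpace M] {cov : Connection m M}
    (hcov : HasFlatSymbols cov) {ι : Type*} [Fintype ι] {φ : ι → M → ℝ}
    (hφ : ∀ i q, IsAffineFunAt cov (φ i) q)
    (hind : ∀ (a : ι → ℝ) (c : ℝ), (∀ q, ∑ i, a i * φ i q = c) → a = 0) {p : M} {a : ι → ℝ}
    (h : ∀ v, ∑ i, a i * mvfderiv (𝓡 m) (φ i) p v = 0) : a = 0 := by
  set f : M → ℝ := ∑ i, a i • φ i with hf
  have hfa : ∀ q, IsAffineFunAt cov f q := fun q ↦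
    .sum fun i _ ↦ (hφ i q).const_smul (a i)
  have hd : mvfderiv (𝓡 m) f p = 0 := by
    have h1 : mvfderiv (𝓡 m) f p = ∑ i, mvfderiv (𝓡 m) (a i • φ i) p :=
      (mvfderiv_finset_sum fun i _ ↦
        ((hφ i p).const_smul (a i)).smooth.mdifferentiableAt (by simp)).2
    ext v
    rw [h1]
    simp only [mvfderiv_const_smul ((hφ _ p).smooth.mdifferentiableAt (by simp))]
    rw [sum_apply]
    exact h v
  refine hind a (f p) fun q ↦ ?_
  rw [← hcov.eq_const hfa hd q, hf]
  simp

/-- A singular Jacobian has a nonzero left null vector, that is, a linear relation between the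
differentials at p. -/
theorem HasFlatSymbols.jacobianDet_ne_zero [PreconnectedSpace M] {cov : Connection m M}
    (hcov : HasFlatSymbols cov) {φ : Fin m → M → ℝ}
    (hφ : ∀ i q, IsAffineFunAt cov (φ i) q)
    (hind : ∀ (a : Fin m → ℝ) (c : ℝ), (∀ q, ∑ i, a i * φ i q = c) → a = 0)
    {x : OpenPartialHomeomorph M (EuclideanSpace ℝ (Fin m))}
    (hx : x ∈ IsManifold.maximalAtlas (𝓡 m) ∞ M) {p : M} (hp : p ∈ x.source) :
    jacobianDet x φ p ≠ 0 := by
  intro h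
  obtain ⟨a, ha, h0⟩ := Matrix.exists_vecMul_eq_zero_iff.2 h
  refine ha (hcov.eq_zero_of_sum_mvfderiv_eq_zero hφ hind (p := p) fun v ↦ ?_)
  have h1 : (∑ i, a i • fderiv ℝ (φ i ∘ x.symm) (x p)) = 0 := by
    refine ContinuousLinearMap.coe_injective ?_
    refine (EuclideanSpace.basisFun (Fin m) ℝ).toBasis.ext fun j ↦ ?_
    have := congrFun h0 j
    simpa [Matrix.vecMul, dotProduct] using this
  have h2 : ∀ w, ∑ i, a i * fderiv ℝ (φ i ∘ x.symm) (x p) w = 0 := fun w ↦ by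
    simpa using congr($h1 w)
  refine Eq.trans (Finset.sum_congr rfl fun i _ ↦ ?_) (h2 (mfderiv (𝓡 m) (𝓡 m) x p v))
  rw [mvfderiv_eq_fderiv_comp_symm hx hp ((hφ i p).smooth.mdifferentiableAt (by simp))]

/-- The map to `ℝᵐ` with given components. -/
def tupleMap (φ : Fin m → M → ℝ) (p : M) : EuclideanSpace ℝ (Fin m) :=
  WithLp.toLp 2 fun i ↦ φ i p

theorem contMDiffAt_tupleMap {φ : Fin m → M → ℝ} {q : M}
    (hφ : ∀ i, ContMDiffAt (𝓡 m) 𝓘(ℝ, ℝ) ∞ (φ i) q) :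
    ContMDiffAt (𝓡 m) (𝓡 m) ∞ (tupleMap φ) q := by
  have hq := mem_chart_source (EuclideanSpace ℝ (Fin m)) q
  have hx := IsManifold.chart_mem_maximalAtlas (I := 𝓡 m) (n := ∞) q
  rw [contMDiffAt_iff_comp_symm hx hq, contDiffAt_euclidean]
  exact fun i ↦ (contMDiffAt_iff_comp_symm hx hq _).1 (hφ i)

/-- The derivative of a component of a vector-valued function. -/
theorem mvfderiv_component {G : M → EuclideanSpace ℝ (Fin m)} {q : M}
    (hG : MDifferentiableAt (𝓡 m) (𝓡 m) G q) (i : Fin m) (v : TangentSpace (𝓡 m) q) :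
    mvfderiv (𝓡 m) (fun q ↦ G q i) q v = (mvfderiv (𝓡 m) G q v) i := by
  have hq := mem_chart_source (EuclideanSpace ℝ (Fin m)) q
  have hx := IsManifold.chart_mem_maximalAtlas (I := 𝓡 m) (n := ∞) q
  have h1 := (mdifferentiableAt_iff_comp_symm hx hq _).1 hG
  have h2 : HasFDerivAt ((fun q ↦ G q i) ∘ (chartAt (EuclideanSpace ℝ (Fin m)) q).symm)
      (EuclideanSpace.proj i ∘L fderiv ℝ (G ∘ (chartAt (EuclideanSpace ℝ (Fin m)) q).symm)
        (chartAt (EuclideanSpace ℝ (Fin m)) q q)) (chartAt (EuclideanSpace ℝ (Fin m)) q q) :=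
    (EuclideanSpace.proj (𝕜 := ℝ) i).hasFDerivAt.comp _ h1.hasFDerivAt
  rw [mvfderiv_eq_fderiv_coordMap hq hG, mvfderiv_eq_fderiv_coordMap hq
    ((mdifferentiableAt_iff_comp_symm hx hq _).2 h2.differentiableAt), h2.fderiv]
  rfl

theorem mfderiv_tupleMap_apply {φ : Fin m → M → ℝ} {q : M}
    (hφ : ∀ i, ContMDiffAt (𝓡 m) 𝓘(ℝ, ℝ) ∞ (φ i) q) (v : TangentSpace (𝓡 m) q) (i : Fin m) :
    (mvfderiv (𝓡 m) (tupleMap φ) q v) i = mvfderiv (𝓡 m) (φ i) q v :=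
  (mvfderiv_component ((contMDiffAt_tupleMap hφ).mdifferentiableAt (by simp)) i v).symm

theorem isInvertible_mfderiv_tupleMap {φ : Fin m → M → ℝ} {q : M}
    (hφ : ∀ i, ContMDiffAt (𝓡 m) 𝓘(ℝ, ℝ) ∞ (φ i) q)
    (hdet : jacobianDet (chartAt (EuclideanSpace ℝ (Fin m)) q) φ q ≠ 0) :
    (mfderiv (𝓡 m) (𝓡 m) (tupleMap φ) q).IsInvertible := by
  have hq := mem_chart_source (EuclideanSpace ℝ (Fin m)) q
  have hinj : ∀ v : EuclideanSpace ℝ (Fin m), mvfderiv (𝓡 m) (tupleMap φ) q v = 0 → v = 0 := by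
    intro v hv
    have h1 := Matrix.eq_zero_of_mulVec_eq_zero hdet (v := v.ofLp) (by
      ext i
      have h2 : 0 = fderiv ℝ (φ i ∘ (chartAt (EuclideanSpace ℝ (Fin m)) q).symm)
          (chartAt (EuclideanSpace ℝ (Fin m)) q q) v := by
        have h3 := mfderiv_tupleMap_apply hφ v i
        rw [hv] at h3
        refine h3.trans ((mvfderiv_eq_fderiv_coordMap hq ((hφ i).mdifferentiableAt (by simp))
          (v : TangentSpace (𝓡 m) q)).trans ?_)
        exact congrArg (fderiv ℝ _ _) (coordMap_self q v)
      have h3 : v = ∑ j, v j • EuclideanSpace.single j (1 : ℝ) := by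
        have := (EuclideanSpace.basisFun (Fin m) ℝ).sum_repr v
        simpa using this.symm
      rw [h3, map_sum] at h2
      simp only [map_smul, smul_eq_mul] at h2
      refine Eq.trans ?_ h2.symm
      simp [Matrix.mulVec, dotProduct, mul_comm])
    ext i
    exact congrFun h1 i
  let L : EuclideanSpace ℝ (Fin m) →L[ℝ] EuclideanSpace ℝ (Fin m) :=
    mfderiv (𝓡 m) (𝓡 m) (tupleMap φ) q
  have hL : Function.Injective L.toLinearMap :=
    (injective_iff_map_eq_zero L.toLinearMap).2 hinj
  refine ⟨(LinearEquiv.ofInjectiveEndo L.toLinearMap hL).toContinuousLinearEquiv, ?_⟩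
  ext v
  rfl

/-- A connection is the pull-back of the trivial connection under local coordinates that are
affine functions. -/
theorem isPullback_trivialConnection {cov : Connection m M} {φ : Fin m → M → ℝ}
    (hφ : ∀ i q, IsAffineFunAt cov (φ i) q)
    (hdet : ∀ q, jacobianDet (chartAt (EuclideanSpace ℝ (Fin m)) q) φ q ≠ 0) :
    IsPullback (tupleMap φ) (trivialConnection m) cov := by
  intro W p hW v
  have hinv : ∀ q, (mfderiv (𝓡 m) (𝓡 m) (tupleMap φ) q).IsInvertible := fun q ↦
    isInvertible_mfderiv_tupleMap (fun i ↦ (hφ i q).smooth) (hdet q)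
  have hΦ : ∀ q, ContMDiffAt (𝓡 m) (𝓡 m) ∞ (tupleMap φ) q := fun q ↦
    contMDiffAt_tupleMap fun i ↦ (hφ i q).smooth
  set Y := VectorField.mpullback (𝓡 m) (𝓡 m) (tupleMap φ) W with hYdef
  have hY : MDifferentiableAt (𝓡 m) (𝓡 m).tangent
      (fun y ↦ (⟨y, Y y⟩ : TangentBundle (𝓡 m) M)) p :=
    hW.mpullback_vectorField (hΦ p) (hinv p) (by norm_cast)
  have hYW : ∀ q, mfderiv (𝓡 m) (𝓡 m) (tupleMap φ) q (Y q) = W (tupleMap φ q) := fun q ↦ by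
    rw [hYdef, VectorField.mpullback_apply]
    exact (hinv q).self_apply_inverse _
  have hWd := differentiableAt_of_field hW
  have hWΦ : MDifferentiableAt (𝓡 m) (𝓡 m)
      (fun q ↦ (W (tupleMap φ q) : EuclideanSpace ℝ (Fin m))) p :=
    hWd.mdifferentiableAt.comp p ((hΦ p).mdifferentiableAt (by simp))
  have hchain : mvfderiv (𝓡 m) (fun q ↦ (W (tupleMap φ q) : EuclideanSpace ℝ (Fin m))) p v =
      fderiv ℝ (fun z ↦ (W z : EuclideanSpace ℝ (Fin m))) (tupleMap φ p)
        (mfderiv (𝓡 m) (𝓡 m) (tupleMap φ) p v) := by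
    have h1 := mfderiv_comp (I := 𝓡 m) (I' := 𝓡 m) (I'' := 𝓡 m) p hWd.mdifferentiableAt
      ((hΦ p).mdifferentiableAt (by simp))
    have h2 : mfderiv (𝓡 m) (𝓡 m) (fun z ↦ (W z : EuclideanSpace ℝ (Fin m))) (tupleMap φ p) =
        fderiv ℝ (fun z ↦ (W z : EuclideanSpace ℝ (Fin m))) (tupleMap φ p) := mfderiv_eq_fderiv
    exact congr($h1 v).trans congr($h2 (mfderiv (𝓡 m) (𝓡 m) (tupleMap φ) p v))
  -- In the i-th component, the vanishing Hessian replaces dφᵢ(∇_v Y) by v(Y φᵢ), and Y φᵢ is the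
  -- i-th component of W ∘ Φ because dΦ maps Y to W.
  have key : mfderiv (𝓡 m) (𝓡 m) (tupleMap φ) p (cov Y p v) =
      trivialConnection m W (tupleMap φ p) (mfderiv (𝓡 m) (𝓡 m) (tupleMap φ) p v) := by
    have h1 : mvfderiv (𝓡 m) (tupleMap φ) p (cov Y p v) =
        mvfderiv (𝓡 m) (fun q ↦ (W (tupleMap φ q) : EuclideanSpace ℝ (Fin m))) p v := by
      ext i
      rw [mfderiv_tupleMap_apply (fun i ↦ (hφ i p).smooth), ← (hφ i p).hess Y hY v,
        ← mvfderiv_component hWΦ]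
      congr 2
      ext q
      rw [← mfderiv_tupleMap_apply (fun i ↦ (hφ i q).smooth)]
      exact congrArg (fun w : EuclideanSpace ℝ (Fin m) ↦ w i) (hYW q)
    exact h1.trans hchain
  rw [← key]
  exact ((hinv p).inverse_apply_self _).symm

end AffineCoordinates

/-! ### Multiplication by e^{-h} in coordinates -/

section Gauge

variable {E : Type*} [NormedAddCommGroup E] [NormedSpace ℝ E]

theorem fderiv_exp_neg_mul {h φ : E → ℝ} {y : E} (hh : DifferentiableAt ℝ h y)
    (hφ : DifferentiableAt ℝ φ y) :
    fderiv ℝ (fun z ↦ Real.exp (-h z) * φ z) y =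
      Real.exp (-h y) • (fderiv ℝ φ y - φ y • fderiv ℝ h y) := by
  rw [(hh.hasFDerivAt.fun_neg.exp.fun_mul hφ.hasFDerivAt).fderiv]
  ext v
  simp
  ring

theorem fderiv_fderiv_exp_neg_mul {h φ : E → ℝ} {y : E} (hh : ContDiffAt ℝ 2 h y)
    (hφ : ContDiffAt ℝ 2 φ y) (a b : E) :
    fderiv ℝ (fderiv ℝ (fun z ↦ Real.exp (-h z) * φ z)) y a b =
      Real.exp (-h y) * (fderiv ℝ (fderiv ℝ φ) y a b - fderiv ℝ h y a * fderiv ℝ φ y b -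
        fderiv ℝ φ y a * fderiv ℝ h y b +
        φ y * (fderiv ℝ h y a * fderiv ℝ h y b - fderiv ℝ (fderiv ℝ h) y a b)) := by
  have h1 : fderiv ℝ (fun z ↦ Real.exp (-h z) * φ z) =ᶠ[𝓝 y] fun z ↦
      Real.exp (-h z) • (fderiv ℝ φ z - φ z • fderiv ℝ h z) := by
    filter_upwards [hh.eventually (by simp), hφ.eventually (by simp)] with z h1 h2
    exact fderiv_exp_neg_mul (h1.differentiableAt (by simp)) (h2.differentiableAt (by simp))
  have h2 := (hh.differentiableAt (by simp)).hasFDerivAt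
  have h3 := (hφ.differentiableAt (by simp)).hasFDerivAt
  have h4 := ((hh.fderiv_right (m := 1) (by norm_num)).differentiableAt (by simp)).hasFDerivAt
  have h5 := ((hφ.fderiv_right (m := 1) (by norm_num)).differentiableAt (by simp)).hasFDerivAt
  rw [h1.fderiv_eq, (h2.fun_neg.exp.fun_smul (h5.fun_sub (h3.fun_smul h4))).fderiv]
  simp
  ring

/-- The cross terms dh ⊗ dφ + dφ ⊗ dh of the product rule cancel against the projective change of
the symbols, so only a multiple of Hess h - dh ⊗ dh remains. -/
theorem hessian_exp_neg_mul {Γ : E →L[ℝ] E →L[ℝ] E} {h φ : E → ℝ} {y : E}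
    (hh : ContDiffAt ℝ 2 h y) (hφ : ContDiffAt ℝ 2 φ y) {a b : E}
    (hab : fderiv ℝ (fderiv ℝ φ) y a b =
      fderiv ℝ φ y ((Γ + projectiveChange E (fderiv ℝ h y)) a b)) :
    fderiv ℝ (fderiv ℝ (fun z ↦ Real.exp (-h z) * φ z)) y a b -
        fderiv ℝ (fun z ↦ Real.exp (-h z) * φ z) y (Γ a b) =
      -(Real.exp (-h y) * φ y * (fderiv ℝ (fderiv ℝ h) y a b - fderiv ℝ h y (Γ a b) -
        fderiv ℝ h y a * fderiv ℝ h y b)) := by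
  simp only [add_apply, projectiveChange_apply, map_add, map_smul, smul_eq_mul] at hab
  rw [fderiv_fderiv_exp_neg_mul hh hφ, fderiv_exp_neg_mul (hh.differentiableAt (by simp))
    (hφ.differentiableAt (by simp)), hab]
  simp only [sub_apply, smul_apply, smul_eq_mul]
  ring

end Gauge

/-! ### Solutions of the quasi-Einstein equation from affine functions -/

section Solutions

variable {m : ℕ} {M : Type*} [TopologicalSpace M]
  [ChartedSpace (EuclideanSpace ℝ (Fin m)) M] [IsManifold (𝓡 m) ∞ M]

theorem IsAffine.differentiableAt_christoffel [T2Space M] {cov : Connection m M}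
    (hcov : IsAffine cov) (p : M) : DifferentiableAt ℝ (christoffel cov p)
      (chartAt (EuclideanSpace ℝ (Fin m)) p p) :=
  ((contDiffOn_christoffel hcov.smooth p).contDiffAt ((chartAt _ p).open_target.mem_nhds
    ((chartAt (EuclideanSpace ℝ (Fin m)) p).map_source (mem_chart_source _ p)))).differentiableAt
      (by simp)

theorem symRicci_eq_zero [T2Space M] {cov : Connection m M} (hcov : IsAffine cov)
    (hflat : IsFlat cov) (p : M) (v w : TangentSpace (𝓡 m) p) : symRicci cov p v w = 0 := by
  have hp := (chartAt (EuclideanSpace ℝ (Fin m)) p).map_source (mem_chart_source _ p)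
  have key : ∀ v w : EuclideanSpace ℝ (Fin m), ∑ i, riemann (christoffel cov p)
      (chartAt (EuclideanSpace ℝ (Fin m)) p p) (EuclideanSpace.single i 1) v w i = 0 := by
    simp [(hcov.hasFlatSymbols hflat).riemann_eq p _ hp]
  have h1 : ∀ v w : TangentSpace (𝓡 m) p, ricci cov p v w = 0 := fun v w ↦
    (ricci_eq (hcov.differentiableAt_christoffel p) v w).trans (key v w)
  simp [symRicci, h1]

theorem isAffineFunAt_of_mem_quasiEinstein [T2Space M] {cov : Connection m M} (hcov : IsAffine cov)
    (hflat : IsFlat cov) {f : M → ℝ} (hf : f ∈ quasiEinstein cov) (q : M) :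
    IsAffineFunAt cov f q := by
  refine isAffineFunAt_of_hessian (hf.1 q) fun X Y hX hY ↦ ?_
  simpa [symRicci_eq_zero hcov hflat] using hf.2 X Y hX hY q

/-- The symmetric Ricci tensor of a connection that a projective change makes flat. -/
theorem symRicci_eq_of_isFlat_perturb [T2Space M] {cov : Connection m M} (hcov : IsAffine cov)
    {h : M → ℝ} (hh : ContMDiff (𝓡 m) 𝓘(ℝ, ℝ) ∞ h) (hflat : IsFlat (perturb h cov)) (p : M)
    (v w : TangentSpace (𝓡 m) p) :
    symRicci cov p v w = ((m : ℝ) - 1) *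
      (fderiv ℝ (fderiv ℝ (h ∘ (chartAt (EuclideanSpace ℝ (Fin m)) p).symm))
          (chartAt (EuclideanSpace ℝ (Fin m)) p p) v w -
        fderiv ℝ (h ∘ (chartAt (EuclideanSpace ℝ (Fin m)) p).symm)
          (chartAt (EuclideanSpace ℝ (Fin m)) p p)
          (christoffel cov p (chartAt (EuclideanSpace ℝ (Fin m)) p p) v w) -
        fderiv ℝ (h ∘ (chartAt (EuclideanSpace ℝ (Fin m)) p).symm)
          (chartAt (EuclideanSpace ℝ (Fin m)) p p) v *
        fderiv ℝ (h ∘ (chartAt (EuclideanSpace ℝ (Fin m)) p).symm)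
          (chartAt (EuclideanSpace ℝ (Fin m)) p p) w) := by
  set x := chartAt (EuclideanSpace ℝ (Fin m)) p
  have hp : p ∈ x.source := mem_chart_source _ p
  have hxp := x.map_source hp
  have hΓ := hcov.differentiableAt_christoffel p
  have hhx : ContDiffAt ℝ 2 (h ∘ x.symm) (x p) :=
    ((contMDiffAt_iff_comp_symm (IsManifold.chart_mem_maximalAtlas p) hp h).1 (hh p)).of_le
      (by norm_cast)
  have hsymm : ∀ a b, christoffel cov p (x p) a b = christoffel cov p (x p) b a :=
    christoffel_symm hcov.torsion_free hxp
  -- Flatness after the projective change leaves R(a, b)c = P(b, c) a - P(a, c) b with P = Hess h -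
  -- dh ⊗ dh.
  have hR : ∀ a b c, riemann (christoffel cov p) (x p) a b c =
      (fderiv ℝ (fderiv ℝ (h ∘ x.symm)) (x p) b c - fderiv ℝ (h ∘ x.symm) (x p)
        (christoffel cov p (x p) b c) -
        fderiv ℝ (h ∘ x.symm) (x p) b * fderiv ℝ (h ∘ x.symm) (x p) c) • a -
      (fderiv ℝ (fderiv ℝ (h ∘ x.symm)) (x p) a c - fderiv ℝ (h ∘ x.symm) (x p)
        (christoffel cov p (x p) a c) -
        fderiv ℝ (h ∘ x.symm) (x p) a * fderiv ℝ (h ∘ x.symm) (x p) c) • b := by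
    intro a b c
    have h1 := riemann_projectiveChange (Γ' := christoffel (perturb h cov) p) hΓ hsymm hhx (by
      filter_upwards [x.open_target.mem_nhds hxp] with z hz
      exact christoffel_perturb hh hz) a b c
    rw [(hcov.hasFlatSymbols_perturb hh hflat).riemann_eq p _ hxp] at h1
    rw [← sub_eq_zero, ← sub_eq_zero.2 h1.symm]
    abel
  have key : ∀ v w : EuclideanSpace ℝ (Fin m), ricci cov p v w = ((m : ℝ) - 1) *
      (fderiv ℝ (fderiv ℝ (h ∘ x.symm)) (x p) v w - fderiv ℝ (h ∘ x.symm) (x p)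
        (christoffel cov p (x p) v w) -
        fderiv ℝ (h ∘ x.symm) (x p) v * fderiv ℝ (h ∘ x.symm) (x p) w) := by
    intro v w
    -- As a linear form in the first slot, P makes the trace computable: the term P(v) id
    -- contributes m P v, and the rank-one term Σ P(eᵢ) vᵢ = P v is subtracted.
    set P : EuclideanSpace ℝ (Fin m) →L[ℝ] ℝ :=
      (fderiv ℝ (fderiv ℝ (h ∘ x.symm)) (x p)).flip w -
        fderiv ℝ (h ∘ x.symm) (x p) ∘L (christoffel cov p (x p)).flip w -
        fderiv ℝ (h ∘ x.symm) (x p) w • fderiv ℝ (h ∘ x.symm) (x p) with hP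
    have hP' : ∀ v, fderiv ℝ (fderiv ℝ (h ∘ x.symm)) (x p) v w - fderiv ℝ (h ∘ x.symm) (x p)
        (christoffel cov p (x p) v w) -
        fderiv ℝ (h ∘ x.symm) (x p) v * fderiv ℝ (h ∘ x.symm) (x p) w = P v := by
      intro v
      simp [hP, mul_comm]
    have hv : v = ∑ j, v j • EuclideanSpace.single j (1 : ℝ) := by
      have := (EuclideanSpace.basisFun (Fin m) ℝ).sum_repr v
      simpa using this.symm
    have hPv : P v = ∑ j, v j * P (EuclideanSpace.single j 1) := by
      conv_lhs => rw [hv, map_sum]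
      simp
    refine (ricci_eq hΓ v w).trans ?_
    refine (Finset.sum_congr rfl fun i _ ↦ congrArg (fun z : EuclideanSpace ℝ (Fin m) ↦ z i)
      (hR (EuclideanSpace.single i 1) v w)).trans ?_
    simp only [hP']
    simp only [PiLp.sub_apply, PiLp.smul_apply, smul_eq_mul, Finset.sum_sub_distrib]
    simp only [PiLp.single_apply, if_true, mul_one, Finset.sum_const, Finset.card_univ,
      Fintype.card_fin, nsmul_eq_mul]
    rw [Finset.sum_congr rfl fun i _ ↦ mul_comm (P (EuclideanSpace.single i 1)) (v i), ← hPv]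
    ring
  -- The Ricci tensor found is already symmetric, so symmetrising it changes nothing.
  have hs : fderiv ℝ (fderiv ℝ (h ∘ x.symm)) (x p) w v =
      fderiv ℝ (fderiv ℝ (h ∘ x.symm)) (x p) v w :=
    hhx.isSymmSndFDerivAt (by simp) w v
  have h1 := key v w
  have h2 := key w v
  rw [hs, hsymm w v] at h2
  rw [symRicci]
  linarith

/-- Affine functions of the flat connection yield solutions for the original connection. -/
theorem exp_neg_mul_mem_quasiEinstein [T2Space M] (hm : 2 ≤ m) {cov : Connection m M}
    (hcov : IsAffine cov) {h : M → ℝ} (hh : ContMDiff (𝓡 m) 𝓘(ℝ, ℝ) ∞ h)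
    (hflat : IsFlat (perturb h cov)) {φ : M → ℝ}
    (hφ : ∀ q, IsAffineFunAt (perturb h cov) φ q) :
    (fun q ↦ Real.exp (-h q) * φ q) ∈ quasiEinstein cov := by
  have hu : ContMDiff (𝓡 m) 𝓘(ℝ, ℝ) ∞ (fun q ↦ Real.exp (-h q) * φ q) := fun q ↦
    (Real.contDiff_exp.contMDiff.contMDiffAt.comp q (hh q).neg).mul (hφ q).smooth
  refine ⟨hu, fun X Y hX hY p ↦ ?_⟩
  have hp := mem_chart_source (EuclideanSpace ℝ (Fin m)) p
  have hx := IsManifold.chart_mem_maximalAtlas (I := 𝓡 m) (n := ∞) p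
  have h1 := hessian_eq cov hp (hu p) ((hY p).mdifferentiableAt (by simp)) (X p)
  have hhx := ((contMDiffAt_iff_comp_symm hx hp h).1 (hh p)).of_le (m := 2) (by norm_cast)
  have hφx := ((contMDiffAt_iff_comp_symm hx hp φ).1 (hφ p).smooth).of_le (m := 2) (by norm_cast)
  have h2 := (isAffineFunAt_iff _ hp (hφ p).smooth).1 (hφ p) (X p) (Y p)
  rw [christoffel_perturb hh ((chartAt (EuclideanSpace ℝ (Fin m)) p).map_source hp)] at h2
  have hm' : (m : ℝ) - 1 ≠ 0 := by
    have : (2 : ℝ) ≤ m := by exact_mod_cast hm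
    linarith
  have h3 : (fun q ↦ Real.exp (-h q) * φ q) ∘ (chartAt (EuclideanSpace ℝ (Fin m)) p).symm =
      fun z ↦ Real.exp (-(h ∘ (chartAt (EuclideanSpace ℝ (Fin m)) p).symm) z) *
        (φ ∘ (chartAt (EuclideanSpace ℝ (Fin m)) p).symm) z := rfl
  rw [coordRep, coordMap_self, coordMap_self, h3] at h1
  rw [hessian, h1.trans (hessian_exp_neg_mul hhx hφx h2),
    symRicci_eq_of_isFlat_perturb hcov hh hflat]
  simp only [Function.comp_apply, (chartAt (EuclideanSpace ℝ (Fin m)) p).left_inv hp]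
  field_simp
  ring

end Solutions

/-! ### Affine functions along coordinate directions -/

section Restriction

variable {m : ℕ} {M : Type*} [TopologicalSpace M]
  [ChartedSpace (EuclideanSpace ℝ (Fin m)) M] [IsManifold (𝓡 m) ∞ M]

/-- On a simply connected manifold with a flat connection, there is an affine function with nonzero
derivative in a given direction. -/
theorem exists_affine_fderiv_ne_zero [SimplyConnectedSpace M] {cov : Connection m M}
    (hcov : HasFlatSymbols cov) {x : OpenPartialHomeomorph M (EuclideanSpace ℝ (Fin m))}
    (hx : x ∈ IsManifold.maximalAtlas (𝓡 m) ∞ M) {p : M} (hp : p ∈ x.source)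
    {e : EuclideanSpace ℝ (Fin m)} (he : e ≠ 0) :
    ∃ φ : M → ℝ, (∀ q, IsAffineFunAt cov φ q) ∧ fderiv ℝ (φ ∘ x.symm) (x p) e ≠ 0 := by
  have hxd : x.MDifferentiable (𝓡 m) (𝓡 m) :=
    ⟨(contMDiffOn_of_mem_maximalAtlas hx).mdifferentiableOn (by simp),
      (contMDiffOn_symm_of_mem_maximalAtlas hx).mdifferentiableOn (by simp)⟩
  obtain ⟨u, hu⟩ : ∃ u : EuclideanSpace ℝ (Fin m), mfderiv (𝓡 m) (𝓡 m) x p u = e :=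
    hxd.mfderiv_surjective hp e
  have hu0 : u ≠ 0 := fun h ↦ he (by rw [← hu, h]; exact map_zero _)
  -- With differential ⟨u, ·⟩ at p, the derivative along u, hence along e in the chart x, is ‖u‖² ≠
  -- 0.
  obtain ⟨φ, hφ, hj⟩ := hcov.exists_affine p (0, innerSL ℝ u)
  refine ⟨φ, hφ, ?_⟩
  have h1 := mvfderiv_eq_fderiv_comp_symm hx hp ((hφ p).smooth.mdifferentiableAt (by simp)) u
  have h2 : mvfderiv (𝓡 m) φ p u = innerSL ℝ u u := congr($(congrArg Prod.snd hj) u)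
  rw [h2, hu] at h1
  rw [← h1]
  simpa using hu0

/-- The coordinate line through p in direction j stays in the slice where xⁱ is constant, and φ is
constant there. -/
theorem fderiv_eq_zero_of_forall_eq {x : OpenPartialHomeomorph M (EuclideanSpace ℝ (Fin m))}
    (hx : x ∈ IsManifold.maximalAtlas (𝓡 m) ∞ M) {p : M} (hp : p ∈ x.source) {φ : M → ℝ}
    (hφ : ContMDiffAt (𝓡 m) 𝓘(ℝ, ℝ) ∞ φ p) {i j : Fin m} (hij : i ≠ j)
    (h : ∀ q ∈ x.source, x q i = x p i → φ q = φ p) :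
    fderiv ℝ (φ ∘ x.symm) (x p) (EuclideanSpace.single j 1) = 0 := by
  have h1 := ((contMDiffAt_iff_comp_symm hx hp φ).1 hφ).differentiableAt (by simp)
  have h2 : HasDerivAt (fun t : ℝ ↦ x p + t • EuclideanSpace.single j (1 : ℝ))
      (EuclideanSpace.single j 1) 0 := by
    simpa using ((hasDerivAt_id (0 : ℝ)).smul_const (EuclideanSpace.single j (1 : ℝ))).const_add
      (x p)
  have h3 : HasDerivAt (fun t : ℝ ↦ (φ ∘ x.symm) (x p + t • EuclideanSpace.single j (1 : ℝ)))
      (fderiv ℝ (φ ∘ x.symm) (x p) (EuclideanSpace.single j 1)) 0 := by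
    have h4 : HasFDerivAt (φ ∘ x.symm) (fderiv ℝ (φ ∘ x.symm) (x p))
        (x p + (0 : ℝ) • EuclideanSpace.single j (1 : ℝ)) := by
      simpa using h1.hasFDerivAt
    exact h4.comp_hasDerivAt (0 : ℝ) h2
  refine h3.unique ((hasDerivAt_const (0 : ℝ) (φ p)).congr_of_eventuallyEq ?_)
  have h4 : ∀ᶠ t : ℝ in 𝓝 0, x p + t • EuclideanSpace.single j (1 : ℝ) ∈ x.target :=
    h2.continuousAt.eventually (x.open_target.mem_nhds (by simpa using x.map_source hp))
  filter_upwards [h4] with t ht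
  refine h _ (x.map_target ht) ?_
  rw [x.right_inv ht]
  simp [hij]

end Restriction

/-! ### The two parts of the theorem -/

section Main

variable {m : ℕ} {M : Type*} [TopologicalSpace M] [T2Space M]
  [ChartedSpace (EuclideanSpace ℝ (Fin m)) M] [IsManifold (𝓡 m) ∞ M] [SimplyConnectedSpace M]

/-- A constant combination is a linear relation once the constant is moved onto the function 1 with
coefficient -c. -/
theorem sum_eq_const_imp_eq_zero {X : Type*} {φ : Fin m → X → ℝ}
    (hind : LinearIndependent ℝ (Fin.cons 1 φ : Fin (m + 1) → X → ℝ)) (a : Fin m → ℝ) (c : ℝ)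
    (h : ∀ q, ∑ i, a i * φ i q = c) : a = 0 := by
  have h1 := Fintype.linearIndependent_iff.1 hind (Fin.cons (-c) a : Fin (m + 1) → ℝ) (by
    rw [Fin.sum_univ_succ]
    ext q
    simp [h])
  ext i
  simpa using h1 i.succ

/-- On the domain of a chart, the solutions are not all products of a fixed positive function with
functions of the coordinate `xⁱ`. -/
theorem exists_mem_quasiEinstein_ne (hm : 2 ≤ m) {cov : Connection m M}
    (hcov : IsAffine cov) (hproj : IsStronglyProjectivelyFlat cov)
    {x : OpenPartialHomeomorph M (EuclideanSpace ℝ (Fin m))}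
    (hx : x ∈ IsManifold.maximalAtlas (𝓡 m) ∞ M) (hne : x.source.Nonempty) (i : Fin m)
    (g : EuclideanSpace ℝ (Fin m) → ℝ) :
    ∃ u ∈ quasiEinstein cov, ∀ k : ℝ → ℝ,
      ∃ p ∈ x.source, u p ≠ Real.exp (g (x p)) * k (x p i) := by
  by_contra! hcon
  obtain ⟨h, hh, hflat⟩ := hproj
  obtain ⟨p, hp⟩ := hne
  have : Nontrivial (Fin m) := Fin.nontrivial_iff_two_le.2 hm
  obtain ⟨j, hij⟩ := exists_ne i
  have hsymb := hcov.hasFlatSymbols_perturb hh hflat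
  obtain ⟨φ, hφ, hne⟩ := exists_affine_fderiv_ne_zero hsymb hx hp
    (e := EuclideanSpace.single j 1) (by simp)
  refine hne (fderiv_eq_zero_of_forall_eq hx hp (hφ p).smooth hij.symm fun q hq hqi ↦ ?_)
  -- The affine functions 1 and φ give the solutions e^{-h} and e^{-h} φ; dividing, φ = k₁ / k₀
  -- depends on xⁱ only.
  obtain ⟨k₀, h₀⟩ := hcon _ (exp_neg_mul_mem_quasiEinstein hm hcov hh hflat
    (isAffineFunAt_const _ 1))
  obtain ⟨k₁, h₁⟩ := hcon _ (exp_neg_mul_mem_quasiEinstein hm hcov hh hflat hφ)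
  have e1 := h₀ q hq
  have e2 := h₀ p hp
  have e3 := h₁ q hq
  have e4 := h₁ p hp
  rw [hqi] at e1 e3
  rw [mul_one] at e1 e2
  rw [e1] at e3
  rw [e2] at e4
  have n1 := (Real.exp_pos (g (x q))).ne'
  have n2 := (Real.exp_pos (g (x p))).ne'
  -- The solution e^{-h} has no zeros, so k₀ may be cancelled.
  have n3 : k₀ (x p i) ≠ 0 := fun h0 ↦ (Real.exp_pos (-h p)).ne' (by rw [e2, h0, mul_zero])
  have e5 : k₀ (x p i) * φ q = k₁ (x p i) := mul_left_cancel₀ n1 (by rw [← e3, mul_assoc])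
  have e6 : k₀ (x p i) * φ p = k₁ (x p i) := mul_left_cancel₀ n2 (by rw [← e4, mul_assoc])
  exact mul_left_cancel₀ n3 (e5.trans e6.symm)

end Main

end AffineManifold

end

theorem theorem2p1 (m : ℕ) (hm : 2 ≤ m) {M : Type*} [TopologicalSpace M] [T2Space M]
    [SecondCountableTopology M] [ChartedSpace (EuclideanSpace ℝ (Fin m)) M]
    [IsManifold (𝓡 m) ∞ M] [SimplyConnectedSpace M]
    (cov : AffineManifold.Connection m M) (hcov : AffineManifold.IsAffine cov) :
    (AffineManifold.IsFlat cov →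
      ∀ φ : Fin m → M → ℝ,
        LinearIndependent ℝ (Fin.cons 1 φ : Fin (m + 1) → M → ℝ) →
        (Submodule.span ℝ (Set.range (Fin.cons 1 φ : Fin (m + 1) → M → ℝ)) : Set (M → ℝ)) =
          AffineManifold.quasiEinstein cov →
        (∀ x ∈ IsManifold.maximalAtlas (𝓡 m) ∞ M, ∀ p ∈ x.source,
          AffineManifold.jacobianDet x φ p ≠ 0) ∧
        AffineManifold.IsPullback
          (fun p ↦ (WithLp.toLp 2 fun i ↦ φ i p : EuclideanSpace ℝ (Fin m)))
          (AffineManifold.trivialConnection m) cov) ∧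
    (AffineManifold.IsStronglyProjectivelyFlat cov → m = 2 →
      ∀ x ∈ IsManifold.maximalAtlas (𝓡 m) ∞ M, x.source.Nonempty →
      ∀ (g : EuclideanSpace ℝ (Fin m) → ℝ) (f : Fin 3 → ℝ → ℝ),
        (fun u : M → ℝ ↦ x.source.domRestrict u) '' AffineManifold.quasiEinstein cov ≠
          {u | ∃ h ∈ Submodule.span ℝ
              (Set.range fun (i : Fin 3) (p : x.source) ↦ f i (x p ⟨0, by omega⟩)),
            u = fun p : x.source ↦ Real.exp (g (x p)) * h p}) := by
  refine ⟨fun hflat φ hind hspan ↦ ?_, fun hproj _ x hx hne g f heq ↦ ?_⟩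
  · have hφ : ∀ i q, AffineManifold.IsAffineFunAt cov (φ i) q := fun i q ↦ by
      refine AffineManifold.isAffineFunAt_of_mem_quasiEinstein hcov hflat ?_ q
      rw [← hspan]
      exact Submodule.subset_span ⟨i.succ, by simp⟩
    have hdet : ∀ x ∈ IsManifold.maximalAtlas (𝓡 m) ∞ M, ∀ p ∈ x.source,
        AffineManifold.jacobianDet x φ p ≠ 0 := fun x hx p hp ↦
      (hcov.hasFlatSymbols hflat).jacobianDet_ne_zero hφ
        (AffineManifold.sum_eq_const_imp_eq_zero hind) hx hp
    exact ⟨hdet, AffineManifold.isPullback_trivialConnection hφ fun q ↦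
      hdet _ (IsManifold.chart_mem_maximalAtlas q) q (mem_chart_source _ q)⟩
  · obtain ⟨u, hu, hun⟩ := AffineManifold.exists_mem_quasiEinstein_ne hm hcov hproj hx hne
      ⟨0, by omega⟩ g
    obtain ⟨h, hh, huh⟩ := heq.subset ⟨u, hu, rfl⟩
    -- All that is needed of the span is that each member is a function of the first coordinate.
    have hk : ∃ k : ℝ → ℝ, ∀ p : x.source, h p = k (x p ⟨0, by omega⟩) := by
      clear huh
      induction hh using Submodule.span_induction with
      | mem h hh =>
        obtain ⟨i, rfl⟩ := hh
        exact ⟨f i, fun _ ↦ rfl⟩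
      | zero => exact ⟨0, fun _ ↦ rfl⟩
      | add h₁ h₂ _ _ ih₁ ih₂ =>
        obtain ⟨k₁, e₁⟩ := ih₁
        obtain ⟨k₂, e₂⟩ := ih₂
        exact ⟨k₁ + k₂, fun p ↦ by simp [e₁, e₂]⟩
      | smul c h _ ih =>
        obtain ⟨k, e⟩ := ih
        exact ⟨c • k, fun p ↦ by simp [e]⟩
    obtain ⟨k, hk⟩ := hk
    obtain ⟨p, hp, hne⟩ := hun k
    exact hne ((congrFun huh ⟨p, hp⟩).trans (by rw [hk]))
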